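/- Let $n\ge 1$, let $\mathbb B\subset\mathbb R^{n+1}$ be the open unit ball with the hyperbolic metric $g=4|dm|^2/(1-|m|^2)^2$, i.e. $\mathbb H^{n+1}$, and let $\mathrm{Vol}$ be its Riemannian measure. Isometries of $\mathbb H^{n+1}$ are extended to $\overline{\mathbb B}=\mathbb B\cup\mathbb S^n$, and $|d\gamma(\xi)|$ is the Euclidean norm of the differential of $\gamma$ at $\xi\in\mathbb S^n$. For $\xi\in\mathbb S^n$ let $\phi_\xi(m)=\log\frac{1-|m|^2}{|m-\xi|^2}$ be the Busemann function. Let $\Gamma$ be a convex co-compact group of isometries of $\mathbb H^{n+1}$: a discrete group of hyperbolic transformations (every element other than the identity has exactly two fixed points in $\overline{\mathbb B}$), not co-compact, such that the quotient by $\Gamma$ of the hyperbolic convex hull of its limit set $\Lambda_\Gamma\subset\mathbb S^n$ is compact. Put $\Omega_\Gamma=\mathbb S^n\setminus\Lambda_\Gamma$, $M=\Gamma\backslash\mathbb H^{n+1}$, $\overline M=\Gamma\backslash(\mathbb B\cup\Omega_\Gamma)$, $\partial\overline M=\Gamma\backslash\Omega_\Gamma$, let $\pi:\mathbb B\cup\Omega_\Gamma\to\overline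 M$ be the projection, and let $g^t$ be the geodesic flow on the unit cotangent bundle $S^*M$. Fix the following data: a boundary defining function $x$ of $\overline M$ and $\varepsilon_0>0$ such that along the geodesic flow on $S^*M$, $x\le\varepsilon_0$ and $\dot x=0$ imply $\ddot x<0$; an open set $U_\infty\subset M\times\partial\overline M$, containing $(M\times\partial\overline M)\cap N$ for some neighbourhood $N$ of the diagonal $\{(\zeta,\zeta):\zeta\in\partial\overline M\}$ in $\overline M\times\partial\overline M$, and given by a lift, that is, by a $\Gamma$-invariant open set $U\subset\mathbb B\times\Omega_\Gamma$ that contains all points of $\mathbb B\times\Omega_\Gamma$ in a neighbourhood of the diagonal $\{(\xi,\xi):\xi\in\Omega_\Gamma\}$, has image $U_\infty$, and is such that $\pi$ is injective on each slice $U_\xi=\{m:(m,\xi)\in U\}$; and a continuous function $c:\Omega_\Gamma\to\mathbb R$ such that the phase function $\phi_\xi(m)+c(\xi)$ is $\Gamma$-invariant, i.e. $\phi_{\gamma\xi}(\gamma m)+c(\gamma\xi)=\phi_\xi(m)+c(\xi)$ for all $\gamma\in\Gamma$, $m\in\mathbb B$, $\xi\in\Omega_\Gamma$. For $\xi\in\Omega_\Gamma$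 let $\tilde\mu_{\pi(\xi)}$ be the measure on $S^*M$ given by $$\int_{S^*M}a\,d\tilde\mu_{\pi(\xi)}=\int_{U_\xi^+}a(m,d\phi_\xi(m))\,e^{n(\phi_\xi(m)+c(\xi))}\,d\mathrm{Vol}(m),\qquad U_\xi^+=\{m\in U_\xi:\ x(m)\le\varepsilon_0,\ \dot x(m,d\phi_\xi(m))\le 0\},$$ where points of $\mathbb B$ and of $S^*\mathbb H^{n+1}$ are projected to $M$ and $S^*M$. The limiting measure $\mu_{\pi(\xi)}$ is the Radon measure on $S^*M$ defined by $$\int_{S^*M}a\,d\mu_{\pi(\xi)}=\lim_{t\to+\infty}\int_{S^*M}a\circ g^{-t}\,d\tilde\mu_{\pi(\xi)}\qquad\text{for all continuous compactly supported } a \text{ on } S^*M .$$ Then for every $\xi\in\Omega_\Gamma$ (not only for almost every $\xi$) the limiting measure $\mu_{\pi(\xi)}$ exists: for all such $a$ the integrals $\int a\circ g^{-t}\,d\tilde\mu_{\pi(\xi)}$ converge absolutely and have a limit as $t\to+\infty$, and there is exactly one Radon measure that represents these limits. Moreover, for every fundamental domain $\mathcal F\subset\mathbb B$ of $\Gamma$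 and every continuous compactly supported $a$ on $S^*M$ (in particular every $a\in C_0^\infty(S^*M)$), $$\int_{S^*M}a\,d\mu_{\pi(\xi)}=e^{n c(\xi)}\int_{\mathcal F}\sum_{\gamma\in\Gamma}a(m,d\phi_{\gamma\xi}(m))\,e^{n(\phi_{\gamma\xi}(m)+\log|d\gamma(\xi)|)}\,d\mathrm{Vol}(m),$$ where the series converges absolutely for every $m\in\mathbb B$ and its sum is integrable on $\mathcal F$. In particular, if the phase function is normalized so that it equals the Busemann function $\phi_\xi$ over $\pi(\xi)$, i.e. $c(\xi)=0$, then the formula holds without the factor $e^{nc(\xi)}$. -/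

import Mathlib

open Set Filter Topology MeasureTheory
open scoped Pointwise ContDiff

noncomputable section

/-! ### The ball model of hyperbolic space -/

/-- The Euclidean space `ℝ^{n+1}`. -/
abbrev Euc (n : ℕ) : Type := EuclideanSpace ℝ (Fin (n + 1))

/-- The open unit ball of `ℝ^{n+1}`, underlying set of hyperbolic space `ℍ^{n+1}`. -/
abbrev HypBall (n : ℕ) : Type := Metric.ball (0 : Euc n) 1

/-- The unit sphere `𝕊^n`, the conformal boundary of `ℍ^{n+1}`. -/
abbrev BdrySphere (n : ℕ) : Type := Metric.sphere (0 : Euc n) 1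

/-- The distance of the hyperbolic metric `4|dm|² / (1 - |m|²)²`. -/
def hypDist {n : ℕ} (m m' : HypBall n) : ℝ :=
  Real.arcosh (1 + 2 * (‖(m : Euc n) - m'‖ ^ 2 /
    ((1 - ‖(m : Euc n)‖ ^ 2) * (1 - ‖(m' : Euc n)‖ ^ 2))))

/-- The Riemannian measure of the hyperbolic metric, `(2 / (1 - |m|²))^{n+1} dm`. -/
def hypVol (n : ℕ) : Measure (HypBall n) :=
  (Measure.comap (Subtype.val : HypBall n → Euc n) volume).withDensity
    fun m => ENNReal.ofReal ((2 / (1 - ‖(m : Euc n)‖ ^ 2)) ^ (n + 1))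

/-- The group of isometries of `ℍ^{n+1}` (orientation reversing ones included). -/
def hypIsom (n : ℕ) : Subgroup (Equiv.Perm (HypBall n)) where
  carrier := {γ | ∀ m m' : HypBall n, hypDist (γ m) (γ m') = hypDist m m'}
  mul_mem' := by
    intro γ δ hγ hδ m m'
    simp only [Equiv.Perm.coe_mul, Function.comp_apply]
    rw [hγ, hδ]
  one_mem' := by intro m m'; rfl
  inv_mem' := by
    intro γ hγ m m'
    have h := hγ (γ⁻¹ m) (γ⁻¹ m')
    simpa using h.symm

/-- The continuous extension of an isometry of the open ball to the closed ball. -/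
def isomExt {n : ℕ} (γ : hypIsom n) : Euc n → Euc n :=
  extendFrom (Metric.ball (0 : Euc n) 1) fun v =>
    open Classical in
    if h : v ∈ Metric.ball (0 : Euc n) 1 then ((γ : Equiv.Perm (HypBall n)) ⟨v, h⟩ : Euc n) else 0

lemma one_sub_sq_pos {n : ℕ} (m : HypBall n) : 0 < 1 - ‖(m : Euc n)‖ ^ 2 := by
  have h : ‖(m : Euc n)‖ < 1 := mem_ball_zero_iff.1 m.2
  nlinarith [norm_nonneg (m : Euc n)]

/-- Isometries preserve the two-point function that defines the distance. -/
lemma isom_twoPoint {n : ℕ} (γ : hypIsom n) (m m' : HypBall n) :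
    ‖((γ : Equiv.Perm (HypBall n)) m : Euc n) - (γ : Equiv.Perm (HypBall n)) m'‖ ^ 2 /
      ((1 - ‖((γ : Equiv.Perm (HypBall n)) m : Euc n)‖ ^ 2) *
        (1 - ‖((γ : Equiv.Perm (HypBall n)) m' : Euc n)‖ ^ 2)) =
    ‖(m : Euc n) - m'‖ ^ 2 / ((1 - ‖(m : Euc n)‖ ^ 2) * (1 - ‖(m' : Euc n)‖ ^ 2)) := by
  have key := γ.2 m m'
  have pos : ∀ p q : HypBall n, 0 ≤ ‖(p : Euc n) - q‖ ^ 2 /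
      ((1 - ‖(p : Euc n)‖ ^ 2) * (1 - ‖(q : Euc n)‖ ^ 2)) := fun p q =>
    div_nonneg (sq_nonneg _) (mul_pos (one_sub_sq_pos p) (one_sub_sq_pos q)).le
  unfold hypDist at key
  have h1 := congrArg Real.cosh key
  have q1 := pos ((γ : Equiv.Perm (HypBall n)) m) ((γ : Equiv.Perm (HypBall n)) m')
  have q2 := pos m m'
  rw [Real.cosh_arcosh (by linarith), Real.cosh_arcosh (by linarith)] at h1
  linarith

/-- An isometry cannot decrease the Euclidean distance to the sphere by more than a factor. -/
lemma isom_bound {n : ℕ} (γ : hypIsom n) : ∃ K : ℝ, 0 < K ∧ ∀ m : HypBall n,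
    1 - ‖((γ : Equiv.Perm (HypBall n)) m : Euc n)‖ ^ 2 ≤ K * (1 - ‖(m : Euc n)‖ ^ 2) := by
  set z : HypBall n := ⟨0, by simp⟩ with hz
  set a : HypBall n := (γ : Equiv.Perm (HypBall n)).symm z with ha
  have hγa : (γ : Equiv.Perm (HypBall n)) a = z := by simp [ha]
  have ha1 : ‖(a : Euc n)‖ < 1 := mem_ball_zero_iff.1 a.2
  have hk : 0 < (1 - ‖(a : Euc n)‖) ^ 2 / 2 := by
    have : 0 < 1 - ‖(a : Euc n)‖ := by linarith
    positivity
  refine ⟨((1 - ‖(a : Euc n)‖) ^ 2 / 2)⁻¹, inv_pos.2 hk, fun m => ?_⟩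
  have h := isom_twoPoint γ m a
  rw [hγa] at h
  simp only [hz, sub_zero, norm_zero, ne_eq, OfNat.ofNat_ne_zero, not_false_eq_true, zero_pow,
    mul_one] at h
  have p1 := one_sub_sq_pos m
  have p2 := one_sub_sq_pos a
  have p3 := one_sub_sq_pos ((γ : Equiv.Perm (HypBall n)) m)
  set R := ‖((γ : Equiv.Perm (HypBall n)) m : Euc n)‖ ^ 2
  have hm1 : ‖(m : Euc n)‖ < 1 := mem_ball_zero_iff.1 m.2
  have htri : (‖(m : Euc n)‖ - ‖(a : Euc n)‖) ^ 2 ≤ ‖(m : Euc n) - a‖ ^ 2 := by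
    have := abs_norm_sub_norm_le (m : Euc n) a
    rw [← sq_abs]
    exact pow_le_pow_left₀ (abs_nonneg _) this 2
  have hD : ‖(m : Euc n) - a‖ ^ 2 ≤ ‖(m : Euc n) - a‖ ^ 2 / (1 - ‖(a : Euc n)‖ ^ 2) := by
    rw [le_div_iff₀ p2]
    nlinarith [sq_nonneg ‖(m : Euc n) - a‖, sq_nonneg ‖(a : Euc n)‖]
  have e1 : (1 - ‖(m : Euc n)‖ ^ 2) = (1 - R) * (1 - ‖(m : Euc n)‖ ^ 2 +
      ‖(m : Euc n) - a‖ ^ 2 / (1 - ‖(a : Euc n)‖ ^ 2)) := by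
    rw [div_eq_div_iff p3.ne' (mul_pos p1 p2).ne'] at h
    field_simp
    linarith
  have low : (1 - ‖(a : Euc n)‖) ^ 2 / 2 ≤ 1 - ‖(m : Euc n)‖ ^ 2 +
      ‖(m : Euc n) - a‖ ^ 2 / (1 - ‖(a : Euc n)‖ ^ 2) := by
    have hn := norm_nonneg (m : Euc n)
    nlinarith [sq_nonneg ((1 - ‖(a : Euc n)‖) - 2 * (1 - ‖(m : Euc n)‖))]
  rw [inv_mul_eq_div, le_div_iff₀ hk, e1]
  exact mul_le_mul_of_nonneg_left low p3.le

lemma isom_lipschitz {n : ℕ} (γ : hypIsom n) : ∃ K : ℝ, 0 < K ∧ ∀ m m' : HypBall n,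
    ‖((γ : Equiv.Perm (HypBall n)) m : Euc n) - (γ : Equiv.Perm (HypBall n)) m'‖ ≤
      K * ‖(m : Euc n) - m'‖ := by
  obtain ⟨K, hK, hb⟩ := isom_bound γ
  refine ⟨K, hK, fun m m' => ?_⟩
  have h := isom_twoPoint γ m m'
  have p1 := one_sub_sq_pos m
  have p2 := one_sub_sq_pos m'
  have p3 := one_sub_sq_pos ((γ : Equiv.Perm (HypBall n)) m)
  have p4 := one_sub_sq_pos ((γ : Equiv.Perm (HypBall n)) m')
  rw [div_eq_div_iff (mul_pos p3 p4).ne' (mul_pos p1 p2).ne'] at h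
  have hb2 := mul_le_mul (hb m) (hb m') p4.le (by positivity)
  refine le_of_sq_le_sq ?_ (by positivity)
  have h3 := mul_le_mul_of_nonneg_left hb2 (sq_nonneg ‖(m : Euc n) - m'‖)
  rw [← h] at h3
  have hpp := mul_pos p1 p2
  refine le_of_mul_le_mul_right ?_ hpp
  calc _ ≤ _ := h3
    _ = _ := by ring

/-- The extension of an isometry maps the sphere to itself. -/
lemma isomExt_mem_sphere {n : ℕ} (γ : hypIsom n) (ξ : BdrySphere n) :
    isomExt γ ξ ∈ Metric.sphere (0 : Euc n) 1 := by
  classical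
  set B := Metric.ball (0 : Euc n) 1 with hB
  set f : Euc n → Euc n := fun v => if h : v ∈ B then
    ((γ : Equiv.Perm (HypBall n)) ⟨v, h⟩ : Euc n) else 0 with hf
  obtain ⟨K, hK, hL⟩ := isom_lipschitz γ
  have hLip : LipschitzOnWith ⟨K, hK.le⟩ f B := by
    refine LipschitzOnWith.of_dist_le_mul fun u hu v hv => ?_
    simp only [hf, hu, hv, dif_pos, dist_eq_norm]
    exact hL ⟨u, hu⟩ ⟨v, hv⟩
  obtain ⟨g, hg, hfg⟩ := hLip.extend_finite_dimension
  have hcl : (ξ : Euc n) ∈ closure B := by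
    rw [hB, closure_ball _ one_ne_zero]
    exact Metric.sphere_subset_closedBall ξ.2
  have hgt : Tendsto g (𝓝[B] (ξ : Euc n)) (𝓝 (g ξ)) :=
    (hg.continuous.tendsto _).mono_left nhdsWithin_le_nhds
  have hft : Tendsto f (𝓝[B] (ξ : Euc n)) (𝓝 (g ξ)) :=
    hgt.congr' (hfg.symm.eventuallyEq_of_mem self_mem_nhdsWithin)
  have heq : isomExt γ ξ = g ξ := by
    unfold isomExt
    convert! extendFrom_eq hcl hft
  rw [heq]
  have : (𝓝[B] (ξ : Euc n)).NeBot := mem_closure_iff_nhdsWithin_neBot.1 hcl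
  obtain ⟨K', -, hb⟩ := isom_bound γ
  have t1 : Tendsto (fun v => ‖f v‖ ^ 2) (𝓝[B] (ξ : Euc n)) (𝓝 (‖g ξ‖ ^ 2)) := hft.norm.pow 2
  have t2 : Tendsto (fun v : Euc n => 1 - K' * (1 - ‖v‖ ^ 2)) (𝓝[B] (ξ : Euc n)) (𝓝 1) := by
    have hc : Continuous fun v : Euc n => 1 - K' * (1 - ‖v‖ ^ 2) := by fun_prop
    have := (hc.tendsto (ξ : Euc n)).mono_left (nhdsWithin_le_nhds (s := B))
    have hξ : ‖(ξ : Euc n)‖ = 1 := mem_sphere_zero_iff_norm.1 ξ.2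
    simpa [hξ] using this
  have lo : 1 ≤ ‖g ξ‖ ^ 2 := by
    refine le_of_tendsto_of_tendsto t2 t1 ?_
    filter_upwards [self_mem_nhdsWithin] with v hv
    have := hb ⟨v, hv⟩
    simp only [hf, hv, dif_pos]
    linarith
  have hi : ‖g ξ‖ ^ 2 ≤ 1 := by
    refine le_of_tendsto t1 ?_
    filter_upwards [self_mem_nhdsWithin] with v hv
    have := one_sub_sq_pos ((γ : Equiv.Perm (HypBall n)) ⟨v, hv⟩)
    simp only [hf, hv, dif_pos]
    linarith
  have : ‖g ξ‖ = 1 := by nlinarith [norm_nonneg (g ξ)]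
  simpa using this

/-- The action of an isometry on the boundary sphere. -/
def bdryMap {n : ℕ} (γ : hypIsom n) (ξ : BdrySphere n) : BdrySphere n :=
  ⟨isomExt γ ξ, isomExt_mem_sphere γ ξ⟩

/-- `|dγ(ξ)|`, the Euclidean operator norm of the differential of `γ` at a boundary point. -/
def bdryDeriv {n : ℕ} (γ : hypIsom n) (ξ : BdrySphere n) : ℝ :=
  ‖fderivWithin ℝ (isomExt γ) (Metric.closedBall 0 1) ξ‖

/-! ### The unit cotangent bundle and the geodesic flow

A covector at a point of the ball is represented by the vector `ν` of `ℝ^{n+1}` that gives it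
through the Euclidean inner product: in the global coordinates of the ball,
`ν ↔ ∑ νᵢ dmᵢ`. In particular the differential of a function is represented by its gradient. -/

/-- The length `|ν|_g = (1 - |m|²)/2 · |ν|` of the covector `ν` at `m`. -/
def covectorNorm {n : ℕ} (m ν : Euc n) : ℝ := (1 - ‖m‖ ^ 2) / 2 * ‖ν‖

/-- The unit cotangent bundle `S*ℍ^{n+1}`. -/
abbrev UnitCotangent (n : ℕ) : Type :=
  {p : HypBall n × Euc n // covectorNorm (p.1 : Euc n) p.2 = 1}

/-- The Hamiltonian `|ν|_g² / 2` of the geodesic flow. -/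
def geodesicHamiltonian {n : ℕ} (m ν : Euc n) : ℝ := covectorNorm m ν ^ 2 / 2

/-- `c` is an orbit of the geodesic flow on `S*ℍ^{n+1}`: it solves Hamilton's equations. -/
def IsGeodesicOrbit {n : ℕ} (c : ℝ → UnitCotangent n) : Prop :=
  ∀ t : ℝ,
    HasDerivAt (fun s => ((c s).1.1 : Euc n))
      (gradient (fun ν => geodesicHamiltonian ((c t).1.1 : Euc n) ν) (c t).1.2) t ∧
    HasDerivAt (fun s => (c s).1.2)
      (-gradient (fun m => geodesicHamiltonian m (c t).1.2) ((c t).1.1 : Euc n)) t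

open Classical in
/-- The geodesic flow `g^t` on `S*ℍ^{n+1}` (the orbit through a point exists and is unique). -/
def geodesicFlow {n : ℕ} (t : ℝ) (v : UnitCotangent n) : UnitCotangent n :=
  if h : ∃ c : ℝ → UnitCotangent n, IsGeodesicOrbit c ∧ c 0 = v then h.choose t else v

/-- The Busemann function `φ_ξ(m) = log ((1 - |m|²) / |m - ξ|²)`. -/
def busemann {n : ℕ} (ξ : BdrySphere n) (m : Euc n) : ℝ :=
  Real.log ((1 - ‖m‖ ^ 2) / ‖m - ξ‖ ^ 2)

lemma hasGradientAt_busemann {n : ℕ} (ξ : BdrySphere n) (m : HypBall n) :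
    HasGradientAt (busemann ξ) (-(2 / (1 - ‖(m : Euc n)‖ ^ 2)) • (m : Euc n) -
      (2 / ‖(m : Euc n) - ξ‖ ^ 2) • ((m : Euc n) - ξ)) (m : Euc n) := by
  have hm1 : ‖(m : Euc n)‖ < 1 := mem_ball_zero_iff.1 m.2
  have hξ : ‖(ξ : Euc n)‖ = 1 := mem_sphere_zero_iff_norm.1 ξ.2
  have p1 := one_sub_sq_pos m
  have hne : (m : Euc n) - ξ ≠ 0 := by
    intro h
    rw [sub_eq_zero.1 h] at hm1
    linarith
  have p2 : 0 < ‖(m : Euc n) - ξ‖ ^ 2 := by positivity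
  have d1 : HasFDerivAt (fun v : Euc n => 1 - ‖v‖ ^ 2)
      (-(2 • (innerSL ℝ (m : Euc n)).comp (ContinuousLinearMap.id ℝ (Euc n)))) (m : Euc n) :=
    ((hasFDerivAt_id (m : Euc n)).norm_sq).const_sub 1
  have d2 : HasFDerivAt (fun v : Euc n => ‖v - (ξ : Euc n)‖ ^ 2)
      (2 • (innerSL ℝ ((m : Euc n) - ξ)).comp (ContinuousLinearMap.id ℝ (Euc n))) (m : Euc n) :=
    ((hasFDerivAt_id (m : Euc n)).sub_const (ξ : Euc n)).norm_sq
  have l := (d1.log p1.ne').sub (d2.log p2.ne')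
  rw [hasGradientAt_iff_hasFDerivAt]
  have ev : busemann ξ =ᶠ[𝓝 (m : Euc n)]
      fun v => Real.log (1 - ‖v‖ ^ 2) - Real.log (‖v - (ξ : Euc n)‖ ^ 2) := by
    have e1 : ∀ᶠ v in 𝓝 (m : Euc n), 0 < 1 - ‖v‖ ^ 2 := d1.continuousAt.eventually (lt_mem_nhds p1)
    have e2 : ∀ᶠ v in 𝓝 (m : Euc n), 0 < ‖v - (ξ : Euc n)‖ ^ 2 := d2.continuousAt.eventually (lt_mem_nhds p2)
    filter_upwards [e1, e2] with v h1 h2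
    exact Real.log_div h1.ne' h2.ne'
  refine HasFDerivAt.congr_of_eventuallyEq ?_ ev
  refine l.congr_fderiv ?_
  ext v
  simp [inner_sub_left, inner_smul_left]
  ring

/-- The differential of a Busemann function is a unit covector. -/
lemma covectorNorm_gradient_busemann {n : ℕ} (ξ : BdrySphere n) (m : HypBall n) :
    covectorNorm (m : Euc n) (gradient (busemann ξ) (m : Euc n)) = 1 := by
  rw [(hasGradientAt_busemann ξ m).gradient]
  have hm1 : ‖(m : Euc n)‖ < 1 := mem_ball_zero_iff.1 m.2
  have hξ : ‖(ξ : Euc n)‖ = 1 := mem_sphere_zero_iff_norm.1 ξ.2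
  have p1 := one_sub_sq_pos m
  have hne : (m : Euc n) - ξ ≠ 0 := by
    intro h
    rw [sub_eq_zero.1 h] at hm1
    linarith
  have p2 : 0 < ‖(m : Euc n) - ξ‖ ^ 2 := by positivity
  set u : Euc n := -(2 / (1 - ‖(m : Euc n)‖ ^ 2)) • (m : Euc n) -
      (2 / ‖(m : Euc n) - ξ‖ ^ 2) • ((m : Euc n) - ξ) with hu
  have hinner : 2 * inner ℝ (m : Euc n) ((m : Euc n) - ξ) =
      ‖(m : Euc n)‖ ^ 2 - 1 + ‖(m : Euc n) - ξ‖ ^ 2 := by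
    rw [norm_sub_sq_real, inner_sub_right, real_inner_self_eq_norm_sq, hξ]
    ring
  have hsq : ‖u‖ ^ 2 = (2 / (1 - ‖(m : Euc n)‖ ^ 2)) ^ 2 := by
    rw [hu, norm_sub_sq_real, norm_smul, norm_smul, inner_smul_left, inner_smul_right, mul_pow,
      mul_pow, Real.norm_eq_abs, Real.norm_eq_abs, sq_abs, sq_abs]
    simp only [conj_trivial]
    have : inner ℝ (m : Euc n) ((m : Euc n) - ξ) =
      (‖(m : Euc n)‖ ^ 2 - 1 + ‖(m : Euc n) - ξ‖ ^ 2) / 2 := by linarith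
    rw [this]
    field_simp
    ring
  have hu2 : ‖u‖ = 2 / (1 - ‖(m : Euc n)‖ ^ 2) :=
    (sq_eq_sq₀ (norm_nonneg _) (by positivity)).1 hsq
  unfold covectorNorm
  rw [hu2]
  field_simp

/-- The point `(m, dφ_ξ(m))` of the unit cotangent bundle. -/
def busemannCovector {n : ℕ} (ξ : BdrySphere n) (m : HypBall n) : UnitCotangent n :=
  ⟨(m, gradient (busemann ξ) (m : Euc n)), covectorNorm_gradient_busemann ξ m⟩

/-! ### Convex co-compact groups -/

/-- The limit set: accumulation points on the sphere of an orbit in the ball. -/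
def limitSet {n : ℕ} (Γ : Subgroup (hypIsom n)) : Set (BdrySphere n) :=
  {p | (p : Euc n) ∈ closure (range fun γ : Γ => ((γ • (⟨0, by simp⟩ : HypBall n) : HypBall n) : Euc n))}

/-- The domain of discontinuity `Ω_Γ`. -/
def discontinuitySet {n : ℕ} (Γ : Subgroup (hypIsom n)) : Set (BdrySphere n) := (limitSet Γ)ᶜ

/-- Unit speed parametrizations of complete hyperbolic geodesics. -/
def IsGeodesicLine {n : ℕ} (σ : ℝ → HypBall n) : Prop := ∀ s t, hypDist (σ s) (σ t) = |s - t|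

/-- Convexity with respect to hyperbolic geodesic segments. -/
def HypConvex {n : ℕ} (C : Set (HypBall n)) : Prop :=
  ∀ p ∈ C, ∀ q ∈ C, ∀ z, hypDist p z + hypDist z q = hypDist p q → z ∈ C

/-- The hyperbolic convex hull of the limit set in `ℍ^{n+1}`: the smallest closed convex set that
contains all geodesics with both end points in the limit set. -/
def limitHull {n : ℕ} (Γ : Subgroup (hypIsom n)) : Set (HypBall n) :=
  ⋂₀ {C | IsClosed C ∧ HypConvex C ∧ ∀ σ : ℝ → HypBall n, IsGeodesicLine σ →
    (∃ p ∈ limitSet Γ, Tendsto (fun t => (σ t : Euc n)) atTop (𝓝 p)) →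
    (∃ q ∈ limitSet Γ, Tendsto (fun t => (σ t : Euc n)) atBot (𝓝 q)) → ∀ t, σ t ∈ C}

/-- The quotient `M = Γ \ ℍ^{n+1}` with the quotient topology. -/
abbrev HypQuotient {n : ℕ} (Γ : Subgroup (hypIsom n)) : Type :=
  MulAction.orbitRel.Quotient Γ (HypBall n)

/-- Convex co-compact groups: discrete groups of hyperbolic transformations (isometries with
exactly two fixed points on the closed ball) with compact convex core, not co-compact. -/
structure IsConvexCocompact {n : ℕ} (Γ : Subgroup (hypIsom n)) : Prop where
  discrete : ProperlyDiscontinuousSMul Γ (HypBall n)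
  hyperbolic : ∀ γ ∈ Γ, γ ≠ 1 →
    {z : Euc n | z ∈ Metric.closedBall 0 1 ∧ isomExt γ z = z}.ncard = 2
  compact_core : IsCompact ((fun m => (Quotient.mk _ m : HypQuotient Γ)) '' limitHull Γ)
  not_cocompact : ¬ CompactSpace (HypQuotient Γ)

/-! ### The unit cotangent bundle of the quotient -/

/-- The covectors `p` and `q` are identified in `S*M`: some `γ ∈ Γ` maps the base point of `p` to
that of `q` and pulls the covector of `q` back to that of `p`. -/
def CotangentRel {n : ℕ} (Γ : Subgroup (hypIsom n)) (p q : UnitCotangent n) : Prop :=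
  ∃ γ ∈ Γ, (γ : Equiv.Perm (HypBall n)) p.1.1 = q.1.1 ∧
    p.1.2 = ContinuousLinearMap.adjoint (fderiv ℝ (isomExt γ) (p.1.1 : Euc n)) q.1.2

/-- The unit cotangent bundle `S*M` of `M = Γ \ ℍ^{n+1}`. -/
def QuotCotangent {n : ℕ} (Γ : Subgroup (hypIsom n)) : Type := Quot (CotangentRel Γ)

instance {n : ℕ} (Γ : Subgroup (hypIsom n)) : TopologicalSpace (QuotCotangent Γ) :=
  inferInstanceAs (TopologicalSpace (Quot (CotangentRel Γ)))

instance {n : ℕ} (Γ : Subgroup (hypIsom n)) : MeasurableSpace (QuotCotangent Γ) := borel _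

instance {n : ℕ} (Γ : Subgroup (hypIsom n)) : BorelSpace (QuotCotangent Γ) := ⟨rfl⟩

/-- The projection `S*ℍ^{n+1} → S*M`. -/
def toQuotCotangent {n : ℕ} (Γ : Subgroup (hypIsom n)) (v : UnitCotangent n) : QuotCotangent Γ :=
  Quot.mk _ v

/-- The geodesic flow of `M`, the projection of that of `ℍ^{n+1}` (which commutes with isometries,
so that the chosen representative does not matter). -/
def quotFlow {n : ℕ} (Γ : Subgroup (hypIsom n)) (t : ℝ) (z : QuotCotangent Γ) : QuotCotangent Γ :=
  toQuotCotangent Γ (geodesicFlow t (Quot.out z))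

/-! ### Limiting measures -/

/-- The choices that enter the definition of the limiting measures of `M = Γ \ ℍ^{n+1}`, with
`M̄ = Γ \ (𝔹 ∪ Ω_Γ)` and all objects written on the cover `𝔹 ∪ Ω_Γ`:
a boundary defining function `x` of `M̄`, for which small sublevel sets satisfy the convexity
condition; an open subset `U_∞` of `M × ∂M̄` that contains a neighbourhood (in `M̄ × ∂M̄`) of the
diagonal of the boundary and whose slices over `ξ` are isometric copies of regions in `𝔹`, given by
its lift `U`; and the phase function `φ_ξ(m) + c(ξ)` on `U_∞`, a Busemann function normalized by an
additive constant that depends on the boundary point. -/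
structure OutgoingData {n : ℕ} (Γ : Subgroup (hypIsom n)) where
  /-- The boundary defining function, lifted to `𝔹 ∪ Ω_Γ`. -/
  x : Euc n → ℝ
  x_smooth : ContDiffOn ℝ ∞ x (Metric.ball 0 1 ∪ Subtype.val '' discontinuitySet Γ)
  x_invariant : ∀ γ ∈ Γ, ∀ z ∈ Metric.ball (0 : Euc n) 1 ∪ Subtype.val '' discontinuitySet Γ,
    x (isomExt γ z) = x z
  x_pos : ∀ m ∈ Metric.ball (0 : Euc n) 1, 0 < x m
  x_bdry : ∀ ξ ∈ discontinuitySet Γ, x ξ = 0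
  x_deriv : ∀ ξ ∈ discontinuitySet Γ,
    fderivWithin ℝ x (Metric.ball 0 1 ∪ Subtype.val '' discontinuitySet Γ) ξ ≠ 0
  /-- The threshold below which sublevel sets of `x` satisfy the convexity condition. -/
  ε₀ : ℝ
  ε₀_pos : 0 < ε₀
  /-- If `x ≤ ε₀` and `ẋ = 0` then `ẍ < 0`, with derivatives along the geodesic flow. -/
  x_convex : ∀ v : UnitCotangent n, x (v.1.1 : Euc n) ≤ ε₀ →
    deriv (fun t => x ((geodesicFlow t v).1.1 : Euc n)) 0 = 0 →
    iteratedDeriv 2 (fun t => x ((geodesicFlow t v).1.1 : Euc n)) 0 < 0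
  /-- The lift of `U_∞`: `(m, ξ) ∈ U` implies `(π m, π ξ) ∈ U_∞`, with `m` the lift of `π m` that
  lies in the region belonging to `ξ`. -/
  U : Set (HypBall n × BdrySphere n)
  U_open : IsOpen U
  U_subset : ∀ m ξ, (m, ξ) ∈ U → ξ ∈ discontinuitySet Γ
  U_invariant : ∀ γ ∈ Γ, ∀ m ξ, (m, ξ) ∈ U →
    ((γ : Equiv.Perm (HypBall n)) m, bdryMap γ ξ) ∈ U
  U_injective : ∀ γ ∈ Γ, ∀ m ξ, (m, ξ) ∈ U → ((γ : Equiv.Perm (HypBall n)) m, ξ) ∈ U → γ = 1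
  U_diagonal : ∀ ξ ∈ discontinuitySet Γ, ∃ r > 0, ∀ (m : HypBall n) (η : BdrySphere n),
    ‖(m : Euc n) - ξ‖ < r → ‖(η : Euc n) - ξ‖ < r → (m, η) ∈ U
  /-- The normalization of the phase function. -/
  c : BdrySphere n → ℝ
  c_cont : ContinuousOn c (discontinuitySet Γ)
  /-- The phase `φ_ξ(m) + c(ξ)` is well defined on the quotient. -/
  phase_invariant : ∀ γ ∈ Γ, ∀ ξ ∈ discontinuitySet Γ, ∀ m : HypBall n,
    busemann (bdryMap γ ξ) ((γ : Equiv.Perm (HypBall n)) m : Euc n) + c (bdryMap γ ξ) =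
      busemann ξ (m : Euc n) + c ξ

/-- The phase function `φ_ξ(m) + c(ξ)` of the outgoing part of the plane waves. -/
def OutgoingData.phase {n : ℕ} {Γ : Subgroup (hypIsom n)} (D : OutgoingData Γ)
    (ξ : BdrySphere n) (m : HypBall n) : ℝ := busemann ξ (m : Euc n) + D.c ξ

/-- The slice of `U_∞⁺` over `π(ξ)`: points `m` with `(m, ξ) ∈ U_∞`, `x(m) ≤ ε₀` and `ẋ ≤ 0` at
`(m, d_m φ_ξ(m))`. -/
def OutgoingData.slice {n : ℕ} {Γ : Subgroup (hypIsom n)} (D : OutgoingData Γ)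
    (ξ : BdrySphere n) : Set (HypBall n) :=
  {m | (m, ξ) ∈ D.U ∧ D.x (m : Euc n) ≤ D.ε₀ ∧
    deriv (fun t => D.x ((geodesicFlow t (busemannCovector ξ m)).1.1 : Euc n)) 0 ≤ 0}

/-- The outgoing measure `μ̃_{π(ξ)}` on `S*M`: the push-forward under `m ↦ (m, d_m φ_ξ(m))` of the
measure `|b⁰|² dVol`, `|b⁰|² = exp (n φ)`, on the slice of `U_∞⁺`. -/
def OutgoingData.outgoingMeasure {n : ℕ} {Γ : Subgroup (hypIsom n)} (D : OutgoingData Γ)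
    (ξ : BdrySphere n) : Measure (QuotCotangent Γ) :=
  (((hypVol n).restrict (D.slice ξ)).withDensity
    fun m => ENNReal.ofReal (Real.exp (n * D.phase ξ m))).map
    fun m => toQuotCotangent Γ (busemannCovector ξ m)

/-- `μ` is the limiting measure `μ_{π(ξ)}`: a Radon measure on `S*M` with
`∫ a dμ = lim_{t → ∞} ∫ a ∘ g^{-t} dμ̃_{π(ξ)}` for all continuous compactly supported `a`. -/
def OutgoingData.IsLimitingMeasure {n : ℕ} {Γ : Subgroup (hypIsom n)} (D : OutgoingData Γ)
    (ξ : BdrySphere n) (μ : Measure (QuotCotangent Γ)) : Prop :=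
  IsFiniteMeasureOnCompacts μ ∧
  ∀ a : QuotCotangent Γ → ℝ, Continuous a → HasCompactSupport a →
    (∀ t : ℝ, Integrable (fun z => a (quotFlow Γ (-t) z)) (D.outgoingMeasure ξ)) ∧
    Tendsto (fun t : ℝ => ∫ z, a (quotFlow Γ (-t) z) ∂(D.outgoingMeasure ξ)) atTop
      (𝓝 (∫ z, a z ∂μ))

end

noncomputable section

/-! ### Isometries of the ball as conformal maps of the closed ball -/

/-! A unit covector on the ball is a pair of a base point `m` and a boundary point `ξ`, the covector
being `dφ_ξ(m)`, and `S*M` is the orbit space of such pairs. The geodesic flow is then explicit. The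
inversion centred at `ξ` turns the ball into a half space whose height function is `exp φ_ξ`, and
the flow towards `ξ` keeps the horizontal coordinates and multiplies the height `y` by `exp t`.
There `exp (n φ_ξ) dVol` is a constant times `dw / y`, with `dw` Lebesgue measure, so the flow
preserves it (`measurePreserving_horoFlow`).

Let `ν` be `exp (n (φ_ξ + c(ξ))) dVol` on the whole ball (`OutgoingData.horoMeasure`). The outgoing
measure is the image in `S*M` of the restriction of `ν` to the slice. Invariance of `ν` turns the
integral of `a ∘ g^{-t}` into the `ν`-integral of `a` along `dφ_ξ`, cut off to those `m` whose image
under the flow for time `t` lies in the slice. Every flow line tends to `ξ`, where `x` tends to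
zero; the convexity condition makes `x` decrease along it eventually, so it ends up in the slice
(`OutgoingData.eventually_mem_slice`). The cut-offs tend to 1 at every point, and by dominated
convergence the limit is the push-forward of `ν`. Nothing here is restricted to almost every `ξ`.

What domination requires is that `ν` gives finite mass to the preimage of a compact subset of `S*M`.
Covering this preimage by translates of a smaller ball reduces it to a locally uniform bound for the
sum of `exp (n φ_ξ(γ m))` over the group. Since the orbit of the origin stays away from `ξ`,
Harnack's inequality reduces that in turn to convergence of the Poincaré series at exponent `n`
(`summable_poincare`), which is a packing estimate: a neighbourhood of `ξ` in the ball lies in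
`U_ξ`, so its translates are disjoint; inside the Euclidean shell of thickness `h`, of volume
`O(h)`, the translate by `γ` occupies volume at least a constant times `h (1 - |γ⁻¹ 0|²)^n`.

The formula is the unfolding of the `ν`-integral over a fundamental domain: `φ_{γξ}(m) + log |dγ(ξ)|
= φ_ξ(γ⁻¹ m)`, and `(m, dφ_{γξ}(m))` and `(γ⁻¹ m, dφ_ξ(γ⁻¹ m))` are the same point of `S*M`. All the
equivariance rests on writing an isometry as a linear isometry, possibly composed with an inversion,
with an explicit conformal factor up to the sphere. -/

/-- The origin of the ball. -/
def ballOrigin (n : ℕ) : HypBall n := ⟨0, by simp⟩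

@[simp] lemma coe_ballOrigin (n : ℕ) : (ballOrigin n : Euc n) = 0 := rfl

/-- Maps of the ball that preserve inner products are restrictions of linear isometries. -/
lemma exists_linearIsometryEquiv_of_inner_eq {n : ℕ} (B : HypBall n → Euc n)
    (hB : ∀ m m', inner ℝ (B m) (B m') = inner ℝ (m : Euc n) (m' : Euc n)) :
    ∃ A : Euc n ≃ₗᵢ[ℝ] Euc n, ∀ m, B m = A m := by
  set b : OrthonormalBasis (Fin (n + 1)) ℝ (Euc n) := EuclideanSpace.basisFun (Fin (n + 1)) ℝ
  -- Basis vectors lie on the sphere, outside the domain of `B`; their halves are used instead, and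
  -- the images are rescaled by 2.
  let p : Fin (n + 1) → HypBall n := fun i => ⟨(2⁻¹ : ℝ) • b i, by
    rw [mem_ball_zero_iff, norm_smul, b.norm_eq_one]; norm_num⟩
  have hp : ∀ i, (p i : Euc n) = (2⁻¹ : ℝ) • b i := fun i => rfl
  have hon : Orthonormal ℝ (fun i => (2 : ℝ) • B (p i)) := by
    have hb := orthonormal_iff_ite.1 b.orthonormal
    rw [orthonormal_iff_ite]
    intro i j
    rw [inner_smul_left, inner_smul_right, hB, hp, hp, inner_smul_left, inner_smul_right, hb]
    simp
  let c : OrthonormalBasis (Fin (n + 1)) ℝ (Euc n) :=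
    (basisOfOrthonormalOfCardEqFinrank hon (by simp)).toOrthonormalBasis (by simpa using hon)
  have hc : ∀ i, c i = (2 : ℝ) • B (p i) := fun i => by simp [c]
  refine ⟨b.equiv c (Equiv.refl _), fun m =>
    InnerProductSpace.ext_inner_left_basis c.toBasis fun i => ?_⟩
  have h1 : (b.equiv c (Equiv.refl _)) (b i) = c i := by simp
  simp only [OrthonormalBasis.coe_toBasis]
  nth_rewrite 2 [← h1]
  rw [LinearIsometryEquiv.inner_map_map, hc, inner_smul_left, hB, hp, inner_smul_left]
  simp

/-- Comparison with the fixed origin shows that `B` preserves norms; the denominators then agree, so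
Euclidean distances and, by polarization, inner products are preserved. -/
lemma exists_linearIsometryEquiv_of_twoPoint {n : ℕ} (B : HypBall n → HypBall n)
    (h0 : B (ballOrigin n) = ballOrigin n)
    (hB : ∀ m m', ‖(B m : Euc n) - B m'‖ ^ 2 /
      ((1 - ‖(B m : Euc n)‖ ^ 2) * (1 - ‖(B m' : Euc n)‖ ^ 2)) =
      ‖(m : Euc n) - m'‖ ^ 2 / ((1 - ‖(m : Euc n)‖ ^ 2) * (1 - ‖(m' : Euc n)‖ ^ 2))) :
    ∃ A : Euc n ≃ₗᵢ[ℝ] Euc n, ∀ m, (B m : Euc n) = A m := by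
  have hnorm : ∀ m, ‖(B m : Euc n)‖ ^ 2 = ‖(m : Euc n)‖ ^ 2 := fun m => by
    have := hB m (ballOrigin n)
    rw [h0] at this
    simp only [coe_ballOrigin, sub_zero, norm_zero, ne_eq, OfNat.ofNat_ne_zero, not_false_eq_true,
      zero_pow, mul_one] at this
    rw [div_eq_div_iff (one_sub_sq_pos _).ne' (one_sub_sq_pos _).ne'] at this
    linarith
  refine exists_linearIsometryEquiv_of_inner_eq _ fun m m' => ?_
  have h := hB m m'
  rw [hnorm, hnorm, div_left_inj' (mul_pos (one_sub_sq_pos m) (one_sub_sq_pos m')).ne',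
    norm_sub_sq_real, norm_sub_sq_real, hnorm, hnorm] at h
  linarith

/-- The point that an isometry sends to the origin. -/
def isomCenter {n : ℕ} (γ : hypIsom n) : HypBall n :=
  (γ : Equiv.Perm (HypBall n)).symm (ballOrigin n)

/-- The factor by which an isometry of the ball scales the Euclidean metric. -/
def confFactor {n : ℕ} (γ : hypIsom n) (x : Euc n) : ℝ :=
  (1 - ‖(isomCenter γ : Euc n)‖ ^ 2) /
    ((1 - ‖x‖ ^ 2) * (1 - ‖(isomCenter γ : Euc n)‖ ^ 2) + ‖x - isomCenter γ‖ ^ 2)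

lemma confFactor_denom_pos {n : ℕ} (a : HypBall n) {x : Euc n} (hx : x ∈ Metric.closedBall 0 1) :
    0 < (1 - ‖x‖ ^ 2) * (1 - ‖(a : Euc n)‖ ^ 2) + ‖x - a‖ ^ 2 := by
  have p := one_sub_sq_pos a
  have hx1 : ‖x‖ ≤ 1 := mem_closedBall_zero_iff.1 hx
  rcases hx1.lt_or_eq with h | h
  · have : 0 < 1 - ‖x‖ ^ 2 := by nlinarith [norm_nonneg x]
    positivity
  · have hne : x - a ≠ 0 := by
      intro h0
      rw [← sub_eq_zero.1 h0, h] at p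
      norm_num at p
    have : 0 < ‖x - a‖ := norm_pos_iff.2 hne
    rw [h]
    positivity

lemma confFactor_pos {n : ℕ} (γ : hypIsom n) {x : Euc n} (hx : x ∈ Metric.closedBall 0 1) :
    0 < confFactor γ x :=
  div_pos (one_sub_sq_pos _) (confFactor_denom_pos _ hx)

/-- `F` is a conformal map of a neighbourhood of the closed ball, with factor `ρ`. -/
structure IsBallConformal {n : ℕ} (F : Euc n → Euc n) (ρ : Euc n → ℝ) : Prop where
  deriv : ∀ x ∈ Metric.closedBall (0 : Euc n) 1, ∃ L : Euc n ≃ₗᵢ[ℝ] Euc n,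
    HasFDerivAt F (ρ x • (L : Euc n →L[ℝ] Euc n)) x
  dist : ∀ x ∈ Metric.closedBall (0 : Euc n) 1, ∀ y ∈ Metric.closedBall (0 : Euc n) 1,
    ‖F x - F y‖ ^ 2 = ρ x * ρ y * ‖x - y‖ ^ 2
  norm : ∀ x ∈ Metric.closedBall (0 : Euc n) 1, 1 - ‖F x‖ ^ 2 = ρ x * (1 - ‖x‖ ^ 2)

lemma IsBallConformal.comp_left {n : ℕ} {F : Euc n → Euc n} {ρ : Euc n → ℝ}
    (h : IsBallConformal F ρ) (A : Euc n ≃ₗᵢ[ℝ] Euc n) : IsBallConformal (A ∘ F) ρ where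
  deriv x hx := by
    obtain ⟨L, hL⟩ := h.deriv x hx
    refine ⟨L.trans A, ((A : Euc n →L[ℝ] Euc n).hasFDerivAt.comp x hL).congr_fderiv ?_⟩
    ext v
    simp
  dist x hx y hy := by
    simp only [Function.comp_apply]
    rw [← map_sub, A.norm_map, h.dist x hx y hy]
  norm x hx := by simpa using h.norm x hx

open EuclideanGeometry in
/-- The inversion that exchanges the origin and `a`. -/
lemma exists_ballInversion {n : ℕ} (a : HypBall n) (ha : (a : Euc n) ≠ 0) :
    ∃ σ : Euc n → Euc n, IsBallConformal σ (fun x => (1 - ‖(a : Euc n)‖ ^ 2) /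
      ((1 - ‖x‖ ^ 2) * (1 - ‖(a : Euc n)‖ ^ 2) + ‖x - a‖ ^ 2)) ∧ σ 0 = a ∧ Function.Involutive σ := by
  set A := ‖(a : Euc n)‖ ^ 2 with hA
  have hApos : 0 < A := by positivity
  have hA1 : 0 < 1 - A := one_sub_sq_pos a
  -- Centre and radius satisfy `|c|² = R² + 1`, so the sphere of inversion is orthogonal to the unit
  -- sphere and the inversion preserves the ball. With `c` on the ray through `a`, sending the
  -- origin to `a` leaves no other choice.
  set c : Euc n := A⁻¹ • (a : Euc n) with hc
  set R := Real.sqrt ((1 - A) / A) with hR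
  have hR2 : R ^ 2 = (1 - A) / A := Real.sq_sqrt (by positivity)
  have hRne : R ≠ 0 := (Real.sqrt_pos.2 (by positivity)).ne'
  have hcx : ∀ x : Euc n, ‖x - c‖ ^ 2 = ((1 - ‖x‖ ^ 2) * (1 - A) + ‖x - a‖ ^ 2) / A := fun x => by
    rw [norm_sub_sq_real, norm_sub_sq_real, hc, inner_smul_right, norm_smul, mul_pow, ← hA]
    rw [Real.norm_eq_abs, sq_abs]
    field_simp
    ring
  have hρ : ∀ x : Euc n, R ^ 2 / ‖x - c‖ ^ 2 =
      (1 - A) / ((1 - ‖x‖ ^ 2) * (1 - A) + ‖x - a‖ ^ 2) := fun x => by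
    rw [hR2, hcx, div_div_div_cancel_right₀ hApos.ne']
  have hne : ∀ x ∈ Metric.closedBall (0 : Euc n) 1, x ≠ c := fun x hx h => by
    have h1 := hcx x
    have h2 := confFactor_denom_pos a hx
    rw [← hA] at h2
    rw [h, sub_self, norm_zero] at h1
    rw [h] at h2
    have := div_pos h2 hApos
    rw [← h1] at this
    norm_num at this
  have hc2 : ‖c‖ ^ 2 = 1 / A := by
    rw [hc, norm_smul, mul_pow, ← hA, Real.norm_eq_abs, sq_abs]
    field_simp
  refine ⟨inversion c R, ⟨fun x hx => ?_, fun x hx y hy => ?_, fun x hx => ?_⟩, ?_,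
    inversion_involutive c hRne⟩
  · refine ⟨(ℝ ∙ (x - c))ᗮ.reflection, ?_⟩
    have := hasFDerivAt_inversion (R := R) (hne x hx)
    rw [div_pow, dist_eq_norm, hρ] at this
    exact this
  · have := dist_inversion_inversion (hne x hx) (hne y hy) R
    rw [dist_eq_norm, dist_eq_norm, dist_eq_norm, dist_eq_norm] at this
    rw [this, ← hρ, ← hρ]
    have hx0 := norm_pos_iff.2 (sub_ne_zero.2 (hne x hx))
    have hy0 := norm_pos_iff.2 (sub_ne_zero.2 (hne y hy))
    field_simp
  · have hx0 := norm_pos_iff.2 (sub_ne_zero.2 (hne x hx))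
    rw [← hρ, show inversion c R x = (R / dist x c) ^ 2 • (x - c) + c from rfl]
    have e1 : ‖x‖ ^ 2 = ‖x - c‖ ^ 2 + 2 * inner ℝ (x - c) c + ‖c‖ ^ 2 := by
      rw [← norm_add_sq_real, sub_add_cancel]
    have hR3 : ‖c‖ ^ 2 = R ^ 2 + 1 := by rw [hc2, hR2]; field_simp; ring
    rw [e1, norm_add_sq_real, norm_smul, inner_smul_left, hR3,
      dist_eq_norm]
    rw [Real.norm_of_nonneg (by positivity), conj_trivial]
    field_simp
    ring
  · rw [inversion_def]
    simp only [dist_eq_norm, zero_sub, norm_neg, vsub_eq_sub, vadd_eq_add, div_pow, hR2, hc2]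
    rw [hc, smul_neg, smul_smul, ← sub_eq_neg_add, ← sub_smul]
    convert! one_smul ℝ (a : Euc n) using 2
    field_simp
    ring

/-- Numerator and denominator both acquire the factor `ρ m * ρ m'`. -/
lemma IsBallConformal.twoPoint {n : ℕ} {F : Euc n → Euc n} {ρ : Euc n → ℝ}
    (h : IsBallConformal F ρ) (hρ : ∀ x ∈ Metric.closedBall (0 : Euc n) 1, 0 < ρ x)
    (m m' : HypBall n) :
    ‖F m - F m'‖ ^ 2 / ((1 - ‖F m‖ ^ 2) * (1 - ‖F m'‖ ^ 2)) =
      ‖(m : Euc n) - m'‖ ^ 2 / ((1 - ‖(m : Euc n)‖ ^ 2) * (1 - ‖(m' : Euc n)‖ ^ 2)) := by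
  have hm := Metric.ball_subset_closedBall m.2
  have hm' := Metric.ball_subset_closedBall m'.2
  rw [h.dist _ hm _ hm', h.norm _ hm, h.norm _ hm']
  have := hρ _ hm
  have := hρ _ hm'
  have := one_sub_sq_pos m
  have := one_sub_sq_pos m'
  field_simp

/-- Every isometry of the ball extends to a conformal map near the closed ball. -/
lemma exists_isBallConformal {n : ℕ} (γ : hypIsom n) :
    ∃ F : Euc n → Euc n, IsBallConformal F (confFactor γ) ∧
      ∀ m : HypBall n, F m = (γ : Equiv.Perm (HypBall n)) m := by
  have hγa : (γ : Equiv.Perm (HypBall n)) (isomCenter γ) = ballOrigin n := by simp [isomCenter]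
  by_cases ha : (isomCenter γ : Euc n) = 0
  -- When the origin is fixed, the centre of the inversion would be at infinity, and `γ` is itself
  -- linear.
  · have ha' : isomCenter γ = ballOrigin n := Subtype.ext ha
    rw [ha'] at hγa
    obtain ⟨A, hA⟩ := exists_linearIsometryEquiv_of_twoPoint _ hγa (isom_twoPoint γ)
    have hρ : confFactor γ = fun _ => 1 := by
      funext x
      simp [confFactor, ha]
    refine ⟨A, ⟨fun x _ => ⟨A, ?_⟩, fun x _ y _ => ?_, fun x _ => ?_⟩, fun m => (hA m).symm⟩
    · rw [hρ, one_smul]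
      exact (A : Euc n →L[ℝ] Euc n).hasFDerivAt
    · rw [hρ, ← map_sub, A.norm_map]; ring
    · rw [hρ, A.norm_map]; ring
  · obtain ⟨σ, hσ, hσ0, hinv⟩ := exists_ballInversion _ ha
    have hρ : ∀ x ∈ Metric.closedBall (0 : Euc n) 1, 0 < confFactor γ x := fun x =>
      confFactor_pos γ
    change IsBallConformal σ (confFactor γ) at hσ
    have hmem : ∀ m : HypBall n, σ m ∈ Metric.ball (0 : Euc n) 1 := fun m => by
      have hm := Metric.ball_subset_closedBall m.2
      have h1 := hσ.norm _ hm
      have h2 := mul_pos (hρ _ hm) (one_sub_sq_pos m)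
      rw [mem_ball_zero_iff]
      nlinarith [norm_nonneg (σ m)]
    -- The map `γ ∘ σ` fixes the origin and preserves the two-point function, so it is a linear
    -- isometry `A`; as `σ` is an involution, `γ = A ∘ σ`.
    obtain ⟨A, hA⟩ := exists_linearIsometryEquiv_of_twoPoint
      (fun m => (γ : Equiv.Perm (HypBall n)) ⟨σ m, hmem m⟩)
      (by
        have : (⟨σ (ballOrigin n), hmem _⟩ : HypBall n) = isomCenter γ := Subtype.ext hσ0
        simp only [this, hγa])
      (fun m m' => (isom_twoPoint γ _ _).trans (hσ.twoPoint hρ m m'))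
    refine ⟨A ∘ σ, hσ.comp_left A, fun m => ?_⟩
    have := hA ⟨σ m, hmem m⟩
    simp only [hinv (m : Euc n)] at this
    exact this.symm

/-- `isomExt` is a limit from inside the ball, which continuity of `F` identifies. The agreement
holds on the closed ball only, so derivatives at the sphere are taken within it. -/
lemma isomExt_eqOn {n : ℕ} (γ : hypIsom n) {F : Euc n → Euc n}
    (hF : IsBallConformal F (confFactor γ))
    (hγ : ∀ m : HypBall n, F m = (γ : Equiv.Perm (HypBall n)) m) :
    EqOn (isomExt γ) F (Metric.closedBall 0 1) := by
  intro x hx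
  obtain ⟨L, hL⟩ := hF.deriv x hx
  unfold isomExt
  refine extendFrom_eq (by rwa [closure_ball _ one_ne_zero]) ?_
  refine (hL.continuousAt.tendsto.mono_left nhdsWithin_le_nhds).congr' ?_
  filter_upwards [self_mem_nhdsWithin] with v hv
  rw [dif_pos hv, ← hγ ⟨v, hv⟩]

lemma isomExt_coe {n : ℕ} (γ : hypIsom n) (m : HypBall n) :
    isomExt γ m = (γ : Equiv.Perm (HypBall n)) m := by
  obtain ⟨F, hF, hγ⟩ := exists_isBallConformal γ
  rw [isomExt_eqOn γ hF hγ (Metric.ball_subset_closedBall m.2), hγ]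

lemma hasFDerivWithinAt_isomExt {n : ℕ} (γ : hypIsom n) {x : Euc n}
    (hx : x ∈ Metric.closedBall 0 1) : ∃ L : Euc n ≃ₗᵢ[ℝ] Euc n,
    HasFDerivWithinAt (isomExt γ) (confFactor γ x • (L : Euc n →L[ℝ] Euc n))
      (Metric.closedBall 0 1) x := by
  obtain ⟨F, hF, hγ⟩ := exists_isBallConformal γ
  obtain ⟨L, hL⟩ := hF.deriv x hx
  exact ⟨L, hL.hasFDerivWithinAt.congr (isomExt_eqOn γ hF hγ) (isomExt_eqOn γ hF hγ hx)⟩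

lemma hasFDerivAt_isomExt {n : ℕ} (γ : hypIsom n) (m : HypBall n) :
    ∃ L : Euc n ≃ₗᵢ[ℝ] Euc n,
      HasFDerivAt (isomExt γ) (confFactor γ m • (L : Euc n →L[ℝ] Euc n)) m := by
  obtain ⟨L, hL⟩ := hasFDerivWithinAt_isomExt γ (Metric.ball_subset_closedBall m.2)
  exact ⟨L, hL.hasFDerivAt (mem_of_superset (Metric.isOpen_ball.mem_nhds m.2)
    Metric.ball_subset_closedBall)⟩

lemma continuousOn_isomExt {n : ℕ} (γ : hypIsom n) :
    ContinuousOn (isomExt γ) (Metric.closedBall 0 1) := fun _ hx =>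
  (hasFDerivWithinAt_isomExt γ hx).choose_spec.continuousWithinAt

lemma norm_isomExt_sub_sq {n : ℕ} (γ : hypIsom n) {x y : Euc n}
    (hx : x ∈ Metric.closedBall 0 1) (hy : y ∈ Metric.closedBall 0 1) :
    ‖isomExt γ x - isomExt γ y‖ ^ 2 = confFactor γ x * confFactor γ y * ‖x - y‖ ^ 2 := by
  obtain ⟨F, hF, hγ⟩ := exists_isBallConformal γ
  rw [isomExt_eqOn γ hF hγ hx, isomExt_eqOn γ hF hγ hy, hF.dist x hx y hy]

lemma one_sub_norm_isomExt_sq {n : ℕ} (γ : hypIsom n) {x : Euc n}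
    (hx : x ∈ Metric.closedBall 0 1) :
    1 - ‖isomExt γ x‖ ^ 2 = confFactor γ x * (1 - ‖x‖ ^ 2) := by
  obtain ⟨F, hF, hγ⟩ := exists_isBallConformal γ
  rw [isomExt_eqOn γ hF hγ hx, hF.norm x hx]

/-- The closed ball is convex with nonempty interior, so the derivative within it is unique even at
the sphere; it is the conformal factor times a linear isometry, which has norm 1. -/
lemma bdryDeriv_eq_confFactor {n : ℕ} (γ : hypIsom n) (ξ : BdrySphere n) :
    bdryDeriv γ ξ = confFactor γ ξ := by
  have hξ := Metric.sphere_subset_closedBall ξ.2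
  obtain ⟨L, hL⟩ := hasFDerivWithinAt_isomExt γ hξ
  have hu : UniqueDiffWithinAt ℝ (Metric.closedBall (0 : Euc n) 1) (ξ : Euc n) :=
    uniqueDiffOn_convex (convex_closedBall _ _)
      ⟨0, by rw [interior_closedBall _ one_ne_zero]; simp⟩ _ hξ
  rw [bdryDeriv, hL.fderivWithin hu, norm_smul, Real.norm_of_nonneg (confFactor_pos γ hξ).le]
  have : ‖(L : Euc n →L[ℝ] Euc n)‖ = 1 := L.toLinearIsometry.norm_toContinuousLinearMap
  rw [this, mul_one]

lemma sphere_sub_ball_pos {n : ℕ} (ξ : BdrySphere n) (m : HypBall n) :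
    0 < ‖(m : Euc n) - ξ‖ := by
  rw [norm_pos_iff, sub_ne_zero]
  intro h
  have h1 : ‖(m : Euc n)‖ < 1 := mem_ball_zero_iff.1 m.2
  rw [h, mem_sphere_zero_iff_norm.1 ξ.2] at h1
  exact lt_irrefl _ h1

lemma exp_busemann {n : ℕ} (ξ : BdrySphere n) (m : HypBall n) :
    Real.exp (busemann ξ (m : Euc n)) = (1 - ‖(m : Euc n)‖ ^ 2) / ‖(m : Euc n) - ξ‖ ^ 2 :=
  Real.exp_log (div_pos (one_sub_sq_pos m) (pow_pos (sphere_sub_ball_pos ξ m) 2))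

/-- Equivariance of the Busemann functions. -/
lemma busemann_bdryMap {n : ℕ} (γ : hypIsom n) (ξ : BdrySphere n) (m : HypBall n) :
    busemann (bdryMap γ ξ) ((γ : Equiv.Perm (HypBall n)) m : Euc n) =
      busemann ξ (m : Euc n) - Real.log (bdryDeriv γ ξ) := by
  have hξ := Metric.sphere_subset_closedBall ξ.2
  have hm := Metric.ball_subset_closedBall m.2
  have p1 := confFactor_pos γ hξ
  have p2 := confFactor_pos γ hm
  have p3 := sphere_sub_ball_pos ξ m
  have p4 := one_sub_sq_pos m
  rw [bdryDeriv_eq_confFactor, busemann, busemann, ← Real.log_div (by positivity) p1.ne',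
    ← isomExt_coe, one_sub_norm_isomExt_sq γ hm]
  simp only [bdryMap]
  rw [norm_isomExt_sub_sq γ hm hξ]
  congr 1
  field_simp

/-! ### The group action on the closed ball and the sphere. -/

lemma isomExt_mem_closedBall {n : ℕ} (γ : hypIsom n) {x : Euc n}
    (hx : x ∈ Metric.closedBall 0 1) : isomExt γ x ∈ Metric.closedBall (0 : Euc n) 1 := by
  have h := one_sub_norm_isomExt_sq γ hx
  have hx1 : ‖x‖ ≤ 1 := mem_closedBall_zero_iff.1 hx
  have : 0 ≤ 1 - ‖x‖ ^ 2 := by nlinarith [norm_nonneg x]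
  have := mul_nonneg (confFactor_pos γ hx).le this
  rw [mem_closedBall_zero_iff]
  nlinarith [norm_nonneg (isomExt γ x)]

lemma isomExt_eqOn_of_eqOn_ball {n : ℕ} {f g : Euc n → Euc n}
    (hf : ContinuousOn f (Metric.closedBall 0 1)) (hg : ContinuousOn g (Metric.closedBall 0 1))
    (h : ∀ m : HypBall n, f m = g m) : EqOn f g (Metric.closedBall 0 1) := by
  have hcl : closure (Metric.ball (0 : Euc n) 1) = Metric.closedBall 0 1 :=
    closure_ball _ one_ne_zero
  refine Set.EqOn.of_subset_closure (s := Metric.ball (0 : Euc n) 1) (fun x hx => h ⟨x, hx⟩) hf hg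
    Metric.ball_subset_closedBall hcl.ge

lemma isomExt_mul {n : ℕ} (γ δ : hypIsom n) {x : Euc n} (hx : x ∈ Metric.closedBall 0 1) :
    isomExt (γ * δ) x = isomExt γ (isomExt δ x) := by
  refine isomExt_eqOn_of_eqOn_ball (g := fun x => isomExt γ (isomExt δ x))
    (continuousOn_isomExt _) ((continuousOn_isomExt γ).comp (continuousOn_isomExt δ)
    fun x hx => isomExt_mem_closedBall δ hx) (fun m => ?_) hx
  simp [isomExt_coe]

lemma isomExt_one {n : ℕ} {x : Euc n} (hx : x ∈ Metric.closedBall 0 1) :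
    isomExt (1 : hypIsom n) x = x :=
  isomExt_eqOn_of_eqOn_ball (g := fun x => x) (continuousOn_isomExt _) continuousOn_id
    (fun m => by simp [isomExt_coe]) hx

/-- The action of the isometries on the sphere. -/
instance bdryAction (n : ℕ) : MulAction (hypIsom n) (BdrySphere n) where
  smul := bdryMap
  one_smul ξ := Subtype.ext (isomExt_one (Metric.sphere_subset_closedBall ξ.2))
  mul_smul γ δ ξ := Subtype.ext (isomExt_mul γ δ (Metric.sphere_subset_closedBall ξ.2))

lemma bdry_smul_def {n : ℕ} (γ : hypIsom n) (ξ : BdrySphere n) : γ • ξ = bdryMap γ ξ := rfl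

lemma ball_smul_def {n : ℕ} (γ : hypIsom n) (m : HypBall n) :
    γ • m = (γ : Equiv.Perm (HypBall n)) m := rfl

instance continuousConstSMul_bdry (n : ℕ) : ContinuousConstSMul (hypIsom n) (BdrySphere n) where
  continuous_const_smul γ := by
    refine Continuous.subtype_mk (f := fun ξ : BdrySphere n => isomExt γ ξ) ?_ _
    exact (continuousOn_isomExt γ).comp_continuous continuous_subtype_val
      fun ξ => Metric.sphere_subset_closedBall ξ.2

instance continuousConstSMul_ball (n : ℕ) : ContinuousConstSMul (hypIsom n) (HypBall n) where
  continuous_const_smul γ := by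
    rw [continuous_induced_rng]
    refine ((continuousOn_isomExt γ).comp_continuous continuous_subtype_val
      fun m => Metric.ball_subset_closedBall m.2).congr fun m => ?_
    exact isomExt_coe γ m

/-! ### The geodesic flow in horospherical coordinates -/

/-- The height of the image of a point under the inversion centred at `ξ` which maps the ball to a
half space. -/
def horoHeight {n : ℕ} (ξ : BdrySphere n) (w : Euc n) : ℝ := 1 - 2 * inner ℝ (ξ : Euc n) w

/-- The geodesic flow towards `ξ` in the half space model: it multiplies the height by `exp t`. -/
def horoAffine {n : ℕ} (ξ : BdrySphere n) (t : ℝ) (w : Euc n) : Euc n :=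
  w - ((Real.exp t - 1) / 2 * horoHeight ξ w) • (ξ : Euc n)

/-- The geodesic flow towards `ξ` on the ball, as a map of `ℝ^{n+1}`. -/
def horoMap {n : ℕ} (ξ : BdrySphere n) (t : ℝ) (x : Euc n) : Euc n :=
  EuclideanGeometry.inversion (ξ : Euc n) 1
    (horoAffine ξ t (EuclideanGeometry.inversion (ξ : Euc n) 1 x))

lemma inner_sphere_self {n : ℕ} (ξ : BdrySphere n) : inner ℝ (ξ : Euc n) (ξ : Euc n) = 1 := by
  rw [real_inner_self_eq_norm_sq, mem_sphere_zero_iff_norm.1 ξ.2, one_pow]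

lemma horoHeight_horoAffine {n : ℕ} (ξ : BdrySphere n) (t : ℝ) (w : Euc n) :
    horoHeight ξ (horoAffine ξ t w) = Real.exp t * horoHeight ξ w := by
  simp only [horoHeight, horoAffine, inner_sub_right, inner_smul_right, inner_sphere_self]
  ring

lemma horoAffine_add {n : ℕ} (ξ : BdrySphere n) (s t : ℝ) (w : Euc n) :
    horoAffine ξ (s + t) w = horoAffine ξ s (horoAffine ξ t w) := by
  rw [horoAffine, horoAffine, horoHeight_horoAffine, horoAffine, Real.exp_add, sub_sub, ← add_smul]
  congr 2
  ring

lemma horoMap_add {n : ℕ} (ξ : BdrySphere n) (s t : ℝ) (x : Euc n) :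
    horoMap ξ (s + t) x = horoMap ξ s (horoMap ξ t x) := by
  simp only [horoMap, horoAffine_add,
    EuclideanGeometry.inversion_inversion (ξ : Euc n) one_ne_zero]

lemma horoMap_zero {n : ℕ} (ξ : BdrySphere n) (x : Euc n) : horoMap ξ 0 x = x := by
  simp [horoMap, horoAffine, EuclideanGeometry.inversion_inversion (ξ : Euc n) one_ne_zero]

lemma inversion_sphere_eq {n : ℕ} (ξ : BdrySphere n) (x : Euc n) :
    EuclideanGeometry.inversion (ξ : Euc n) 1 x = (‖x - ξ‖ ^ 2)⁻¹ • (x - ξ) + ξ := by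
  rw [EuclideanGeometry.inversion, dist_eq_norm, vsub_eq_sub, vadd_eq_add, div_pow, one_pow, one_div]

/-- This identity is why the inversion exchanges the ball with the half space of positive height,
and why the height is the exponential of the Busemann function. -/
lemma one_sub_norm_sq_eq {n : ℕ} (ξ : BdrySphere n) {x : Euc n} (hx : x ≠ ξ) :
    1 - ‖x‖ ^ 2 =
      horoHeight ξ (EuclideanGeometry.inversion (ξ : Euc n) 1 x) * ‖x - ξ‖ ^ 2 := by
  have h0 : ‖x - ξ‖ ≠ 0 := norm_ne_zero_iff.2 (sub_ne_zero.2 hx)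
  have e1 : ‖x‖ ^ 2 = ‖x - ξ‖ ^ 2 + 2 * inner ℝ (x - ξ) (ξ : Euc n) + ‖(ξ : Euc n)‖ ^ 2 := by
    rw [← norm_add_sq_real, sub_add_cancel]
  rw [e1, inversion_sphere_eq, horoHeight, inner_add_right, inner_smul_right, inner_sphere_self,
    real_inner_comm, mem_sphere_zero_iff_norm.1 ξ.2]
  field_simp
  ring

lemma ne_of_horoHeight_pos {n : ℕ} {ξ : BdrySphere n} {w : Euc n} (hw : 0 < horoHeight ξ w) :
    w ≠ ξ := by
  rintro rfl
  rw [horoHeight, inner_sphere_self] at hw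
  norm_num at hw

lemma inversion_mem_ball_iff {n : ℕ} {ξ : BdrySphere n} {w : Euc n} (hw : 0 < horoHeight ξ w) :
    EuclideanGeometry.inversion (ξ : Euc n) 1 w ∈ Metric.ball (0 : Euc n) 1 := by
  have h1 := ne_of_horoHeight_pos hw
  have h2 : EuclideanGeometry.inversion (ξ : Euc n) 1 w ≠ ξ := by
    rwa [Ne, EuclideanGeometry.inversion_eq_center one_ne_zero]
  have h := one_sub_norm_sq_eq ξ h2
  rw [EuclideanGeometry.inversion_inversion (ξ : Euc n) one_ne_zero] at h
  have h3 : 0 < ‖EuclideanGeometry.inversion (ξ : Euc n) 1 w - ξ‖ :=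
    norm_pos_iff.2 (sub_ne_zero.2 h2)
  have h4 : 0 < 1 - ‖EuclideanGeometry.inversion (ξ : Euc n) 1 w‖ ^ 2 := by rw [h]; positivity
  rw [mem_ball_zero_iff]
  nlinarith [norm_nonneg (EuclideanGeometry.inversion (ξ : Euc n) 1 w)]

lemma ball_ne_sphere {n : ℕ} (ξ : BdrySphere n) (m : HypBall n) : (m : Euc n) ≠ ξ :=
  sub_ne_zero.1 (norm_pos_iff.1 (sphere_sub_ball_pos ξ m))

lemma horoHeight_inversion {n : ℕ} (ξ : BdrySphere n) (m : HypBall n) :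
    horoHeight ξ (EuclideanGeometry.inversion (ξ : Euc n) 1 m) =
      Real.exp (busemann ξ (m : Euc n)) := by
  have := sphere_sub_ball_pos ξ m
  rw [exp_busemann, one_sub_norm_sq_eq ξ (ball_ne_sphere ξ m)]
  field_simp

lemma horoHeight_pos {n : ℕ} (ξ : BdrySphere n) (m : HypBall n) (t : ℝ) :
    0 < horoHeight ξ (horoAffine ξ t (EuclideanGeometry.inversion (ξ : Euc n) 1 m)) := by
  rw [horoHeight_horoAffine, horoHeight_inversion]
  positivity

/-- The geodesic flow towards `ξ` on the ball. -/
def horoFlow {n : ℕ} (ξ : BdrySphere n) (t : ℝ) (m : HypBall n) : HypBall n :=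
  ⟨horoMap ξ t m, inversion_mem_ball_iff (horoHeight_pos ξ m t)⟩

lemma horoFlow_add {n : ℕ} (ξ : BdrySphere n) (s t : ℝ) (m : HypBall n) :
    horoFlow ξ (s + t) m = horoFlow ξ s (horoFlow ξ t m) :=
  Subtype.ext (horoMap_add ξ s t m)

lemma horoFlow_zero {n : ℕ} (ξ : BdrySphere n) (m : HypBall n) : horoFlow ξ 0 m = m :=
  Subtype.ext (horoMap_zero ξ m)

lemma horoFlow_neg_horoFlow {n : ℕ} (ξ : BdrySphere n) (t : ℝ) (m : HypBall n) :
    horoFlow ξ (-t) (horoFlow ξ t m) = m := by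
  rw [← horoFlow_add, neg_add_cancel, horoFlow_zero]

lemma horoFlow_horoFlow_neg {n : ℕ} (ξ : BdrySphere n) (t : ℝ) (m : HypBall n) :
    horoFlow ξ t (horoFlow ξ (-t) m) = m := by
  rw [← horoFlow_add, add_neg_cancel, horoFlow_zero]

lemma exp_busemann_horoFlow {n : ℕ} (ξ : BdrySphere n) (t : ℝ) (m : HypBall n) :
    Real.exp (busemann ξ (horoFlow ξ t m : Euc n)) =
      Real.exp t * Real.exp (busemann ξ (m : Euc n)) := by
  rw [← horoHeight_inversion, ← horoHeight_inversion, ← horoHeight_horoAffine]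
  simp only [horoFlow, horoMap, EuclideanGeometry.inversion_inversion (ξ : Euc n) one_ne_zero]

/-- The flow lines end at `ξ`. -/
lemma tendsto_horoFlow {n : ℕ} (ξ : BdrySphere n) (m : HypBall n) :
    Tendsto (fun t => (horoFlow ξ t m : Euc n)) atTop (𝓝 (ξ : Euc n)) := by
  rw [tendsto_iff_dist_tendsto_zero]
  have hd : ∀ t, dist (horoFlow ξ t m : Euc n) ξ =
      1 / dist (horoAffine ξ t (EuclideanGeometry.inversion (ξ : Euc n) 1 m)) ξ := fun t => by
    have := EuclideanGeometry.dist_inversion_center (ξ : Euc n)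
      (horoAffine ξ t (EuclideanGeometry.inversion (ξ : Euc n) 1 m)) 1
    rwa [one_pow] at this
  simp_rw [hd, one_div]
  refine Tendsto.inv_tendsto_atTop ?_
  -- For a point `w` of height `y`, the inner product of `ξ` with `w - ξ` is `-(1 + y) / 2`, so the
  -- distance from `w` to `ξ` exceeds `y / 2`.
  have hle : ∀ t, Real.exp t * Real.exp (busemann ξ (m : Euc n)) / 2 ≤
      dist (horoAffine ξ t (EuclideanGeometry.inversion (ξ : Euc n) 1 m)) ξ := fun t => by
    have h1 := horoHeight_horoAffine ξ t (EuclideanGeometry.inversion (ξ : Euc n) 1 m)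
    rw [horoHeight_inversion] at h1
    set w := horoAffine ξ t (EuclideanGeometry.inversion (ξ : Euc n) 1 m)
    have h2 := abs_real_inner_le_norm (ξ : Euc n) (w - ξ)
    rw [inner_sub_right, inner_sphere_self, mem_sphere_zero_iff_norm.1 ξ.2, one_mul] at h2
    rw [dist_eq_norm]
    have h3 := neg_abs_le (inner ℝ (ξ : Euc n) w - 1)
    rw [horoHeight] at h1
    linarith
  refine tendsto_atTop_mono hle ?_
  exact (Real.tendsto_exp_atTop.atTop_mul_const (Real.exp_pos _)).atTop_div_const two_pos

lemma gradient_geodesicHamiltonian_right {n : ℕ} (m ν : Euc n) :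
    gradient (fun ν => geodesicHamiltonian m ν) ν = (((1 - ‖m‖ ^ 2) / 2) ^ 2) • ν := by
  refine HasGradientAt.gradient ?_
  have h1 := ((hasFDerivAt_id ν).norm_sq).const_mul (((1 - ‖m‖ ^ 2) / 2) ^ 2 / 2)
  rw [hasGradientAt_iff_hasFDerivAt]
  have e : (fun ν => geodesicHamiltonian m ν) =
      fun ν : Euc n => ((1 - ‖m‖ ^ 2) / 2) ^ 2 / 2 * ‖id ν‖ ^ 2 := by
    funext v; simp only [geodesicHamiltonian, covectorNorm, id]; ring
  rw [e]
  refine h1.congr_fderiv ?_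
  ext v
  simp
  ring

lemma gradient_geodesicHamiltonian_left {n : ℕ} (m ν : Euc n) :
    -gradient (fun m => geodesicHamiltonian m ν) m = ((1 - ‖m‖ ^ 2) / 2 * ‖ν‖ ^ 2) • m := by
  rw [neg_eq_iff_eq_neg]
  refine HasGradientAt.gradient ?_
  have h1 := ((((hasFDerivAt_id m).norm_sq).const_sub 1).pow 2).const_mul (‖ν‖ ^ 2 / 8)
  rw [hasGradientAt_iff_hasFDerivAt]
  have e : (fun m => geodesicHamiltonian m ν) =
      fun m : Euc n => ‖ν‖ ^ 2 / 8 * (1 - ‖id m‖ ^ 2) ^ 2 := by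
    funext v; simp only [geodesicHamiltonian, covectorNorm, id]; ring
  rw [e]
  refine h1.congr_fderiv ?_
  ext v
  simp
  ring

/-- Orbits of the geodesic flow are determined by their initial points. -/
lemma IsGeodesicOrbit.eq {n : ℕ} {c d : ℝ → UnitCotangent n} (hc : IsGeodesicOrbit c)
    (hd : IsGeodesicOrbit d) (h0 : c 0 = d 0) : c = d := by
  let V : Euc n × Euc n → Euc n × Euc n := fun p =>
    ((((1 - ‖p.1‖ ^ 2) / 2) ^ 2) • p.2, ((1 - ‖p.1‖ ^ 2) / 2 * ‖p.2‖ ^ 2) • p.1)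
  have hV : ContDiff ℝ 1 V := by
    have h1 : ContDiff ℝ 1 fun p : Euc n × Euc n => ‖p.1‖ ^ 2 := contDiff_fst.norm_sq ℝ
    have h2 : ContDiff ℝ 1 fun p : Euc n × Euc n => ‖p.2‖ ^ 2 := contDiff_snd.norm_sq ℝ
    exact ContDiff.prodMk ((((contDiff_const.sub h1).div_const 2).pow 2).smul contDiff_snd)
      ((((contDiff_const.sub h1).div_const 2).mul h2).smul contDiff_fst)
  let emb : UnitCotangent n → Euc n × Euc n := fun v => ((v.1.1 : Euc n), v.1.2)
  have hemb : Function.Injective emb := fun v w h =>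
    Subtype.ext (Prod.ext (Subtype.ext (Prod.ext_iff.1 h).1) (Prod.ext_iff.1 h).2)
  have hder : ∀ {c : ℝ → UnitCotangent n}, IsGeodesicOrbit c → ∀ t,
      HasDerivAt (fun s => emb (c s)) (V (emb (c t))) t := fun {c} hc t => by
    have := hc t
    rw [gradient_geodesicHamiltonian_left, gradient_geodesicHamiltonian_right] at this
    exact this.1.prodMk this.2
  have cont : ∀ {c : ℝ → UnitCotangent n}, IsGeodesicOrbit c → Continuous fun s => emb (c s) :=
    fun hc => continuous_iff_continuousAt.2 fun t => (hder hc t).continuousAt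
  -- The polynomial field `V` need not be globally Lipschitz. Local uniqueness makes the set of
  -- agreement open, and connectedness of `ℝ` finishes.
  have hclopen : IsClopen {t | emb (c t) = emb (d t)} := by
    refine ⟨isClosed_eq (cont hc) (cont hd), isOpen_iff_mem_nhds.2 fun t ht => ?_⟩
    obtain ⟨K, s, hs, hL⟩ := hV.contDiffAt.exists_lipschitzOnWith (x := emb (c t))
    have hs' : s ∈ 𝓝 (emb (d t)) := by rwa [← show emb (c t) = emb (d t) from ht]
    exact ODE_solution_unique_of_eventually (v := fun _ => V) (s := fun _ => s)
      (Eventually.of_forall fun _ => hL)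
      (((cont hc).continuousAt.eventually hs).mono fun u hu => ⟨hder hc u, hu⟩)
      (((cont hd).continuousAt.eventually hs').mono fun u hu => ⟨hder hd u, hu⟩) ht
  have huniv := hclopen.eq_univ ⟨0, congrArg emb h0⟩
  funext t
  exact hemb (huniv.ge (mem_univ t))

lemma geodesicFlow_eq {n : ℕ} {c : ℝ → UnitCotangent n} (hc : IsGeodesicOrbit c) (t : ℝ) :
    geodesicFlow t (c 0) = c t := by
  have h : ∃ d : ℝ → UnitCotangent n, IsGeodesicOrbit d ∧ d 0 = c 0 := ⟨c, hc, rfl⟩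
  rw [geodesicFlow, dif_pos h]
  exact congrFun (h.choose_spec.1.eq hc h.choose_spec.2) t

/-- In half space coordinates `u = w_t - ξ`, with height `y`, one has `y' = y` and `u' = -(y / 2)
ξ`. Position and covector are combinations of `u` and `ξ` with coefficients rational in `y` and
`|u|²`, so Hamilton's equations can be compared coefficient by coefficient. -/
lemma isGeodesicOrbit_horoFlow {n : ℕ} (ξ : BdrySphere n) (m : HypBall n) :
    IsGeodesicOrbit fun t => busemannCovector ξ (horoFlow ξ t m) := by
  set w := EuclideanGeometry.inversion (ξ : Euc n) 1 m with hw
  set y : ℝ → ℝ := fun t => Real.exp t * horoHeight ξ w with hy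
  set u : ℝ → Euc n := fun t => horoAffine ξ t w - ξ with hu
  have hpos : ∀ t, 0 < y t := fun t => by
    have := horoHeight_pos ξ m t
    rwa [horoHeight_horoAffine] at this
  have hinner : ∀ t, inner ℝ (u t) (ξ : Euc n) = -(1 + y t) / 2 := fun t => by
    have := horoHeight_horoAffine ξ t w
    simp only [hu, hy]
    rw [inner_sub_left, inner_sphere_self, ← this, real_inner_comm, horoHeight]
    ring
  have hu0 : ∀ t, 0 < ‖u t‖ ^ 2 := fun t => by
    have : u t ≠ 0 := fun h0 => by
      have := hinner t
      rw [h0, inner_zero_left] at this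
      linarith [hpos t]
    positivity
  have hun : ∀ t, ‖u t‖ ≠ 0 := fun t h0 => by
    have := hu0 t
    rw [h0] at this
    norm_num at this
  have hy' : ∀ t, HasDerivAt y (y t) t := fun t => (Real.hasDerivAt_exp t).mul_const _
  have hu' : ∀ t, HasDerivAt u (-(y t / 2) • (ξ : Euc n)) t := fun t => by
    have h1 := (((((Real.hasDerivAt_exp t).sub_const 1).div_const 2).mul_const
      (horoHeight ξ w)).smul_const (ξ : Euc n)).const_sub w |>.sub_const (ξ : Euc n)
    refine h1.congr_deriv ?_
    rw [← neg_smul]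
    congr 1
    simp only [hy]; ring
  have hm : ∀ t, (horoFlow ξ t m : Euc n) = (‖u t‖ ^ 2)⁻¹ • u t + ξ := fun t =>
    inversion_sphere_eq ξ _
  have hmξ : ∀ t, (horoFlow ξ t m : Euc n) - ξ = (‖u t‖ ^ 2)⁻¹ • u t := fun t => by
    rw [hm, add_sub_cancel_right]
  have hnorm1 : ∀ t, ‖(horoFlow ξ t m : Euc n) - ξ‖ ^ 2 = (‖u t‖ ^ 2)⁻¹ := fun t => by
    have := hu0 t
    rw [hmξ, norm_smul, mul_pow, Real.norm_of_nonneg (by positivity)]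
    field_simp
  have hnorm2 : ∀ t, 1 - ‖(horoFlow ξ t m : Euc n)‖ ^ 2 = y t / ‖u t‖ ^ 2 := fun t => by
    rw [one_sub_norm_sq_eq ξ (ball_ne_sphere ξ _), hnorm1, horoHeight_inversion,
      exp_busemann_horoFlow, ← horoHeight_inversion, div_eq_mul_inv]
  have hν : ∀ t, gradient (busemann ξ) (horoFlow ξ t m : Euc n) =
      -(2 / y t) • (‖u t‖ ^ 2 • (ξ : Euc n) + u t) - (2 : ℝ) • u t := fun t => by
    have h1 := hu0 t
    have h2 := hpos t
    have h3 := hun t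
    rw [(hasGradientAt_busemann ξ _).gradient, hnorm1, hnorm2, hmξ, hm]
    match_scalars <;> field_simp <;> ring
  -- The value of `⟨u, ξ⟩` in `hinner` closes the system: no inner product other than `|u|²`
  -- remains.
  have hq' : ∀ t, HasDerivAt (fun t => ‖u t‖ ^ 2) (y t * (1 + y t) / 2) t := fun t => by
    refine (hu' t).norm_sq.congr_deriv ?_
    rw [inner_smul_right, hinner]
    ring
  intro t
  have h1 := hu0 t
  have h2 := hpos t
  have h3 := hun t
  rw [gradient_geodesicHamiltonian_left, gradient_geodesicHamiltonian_right]
  have hcov := covectorNorm_gradient_busemann ξ (horoFlow ξ t m)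
  simp only [busemannCovector]
  rw [covectorNorm, hnorm2] at hcov
  constructor
  · simp_rw [hm]
    refine ((((hq' t).fun_inv h1.ne').fun_smul (hu' t)).add_const (ξ : Euc n)).congr_deriv ?_
    rw [← hm, hν, hnorm2]
    match_scalars <;> field_simp <;> ring
  -- The norm of the covector comes from its unit length rather than from expanding the gradient.
  · have hν2 : ‖gradient (busemann ξ) (horoFlow ξ t m : Euc n)‖ ^ 2 =
        (2 * ‖u t‖ ^ 2 / y t) ^ 2 := by
      congr 1
      field_simp at hcov ⊢
      exact hcov
    rw [hν2, hnorm2]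
    simp_rw [hν]
    refine ((((hasDerivAt_const t (2 : ℝ)).fun_div (hy' t) h2.ne').fun_neg.fun_smul
      (((hq' t).smul_const (ξ : Euc n)).fun_add (hu' t))).fun_sub ((hu' t).fun_const_smul 2)).congr_deriv ?_
    rw [hm]
    match_scalars <;> field_simp <;> ring

/-- The geodesic flow on the differential of a Busemann function. -/
lemma geodesicFlow_busemannCovector {n : ℕ} (ξ : BdrySphere n) (t : ℝ) (m : HypBall n) :
    geodesicFlow t (busemannCovector ξ m) = busemannCovector ξ (horoFlow ξ t m) := by
  have := geodesicFlow_eq (isGeodesicOrbit_horoFlow ξ m) t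
  rwa [horoFlow_zero] at this

/-! ### The geodesic flow commutes with isometries -/

/-- The two-point function in the half space model: squared Euclidean distance over the product of
the heights. -/
lemma norm_sub_sq_eq_inversion {n : ℕ} (ξ : BdrySphere n) (m m' : HypBall n) :
    ‖(m : Euc n) - m'‖ ^ 2 / ((1 - ‖(m : Euc n)‖ ^ 2) * (1 - ‖(m' : Euc n)‖ ^ 2)) =
      ‖EuclideanGeometry.inversion (ξ : Euc n) 1 m - EuclideanGeometry.inversion (ξ : Euc n) 1 m'‖ ^ 2
        / (Real.exp (busemann ξ m) * Real.exp (busemann ξ m')) := by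
  have h := EuclideanGeometry.dist_inversion_inversion (ball_ne_sphere ξ m) (ball_ne_sphere ξ m') 1
  rw [dist_eq_norm, dist_eq_norm, dist_eq_norm, dist_eq_norm] at h
  have h1 := sphere_sub_ball_pos ξ m
  have h2 := sphere_sub_ball_pos ξ m'
  have h3 := one_sub_sq_pos m
  have h4 := one_sub_sq_pos m'
  rw [h, exp_busemann, exp_busemann]
  field_simp

/-- The flow towards `ξ` is characterized by distances and values of the Busemann function. -/
lemma eq_horoFlow_iff {n : ℕ} (ξ : BdrySphere n) (t : ℝ) (m m' : HypBall n) :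
    m' = horoFlow ξ t m ↔
      (Real.exp (busemann ξ m') = Real.exp t * Real.exp (busemann ξ m) ∧
      ‖(m : Euc n) - m'‖ ^ 2 / ((1 - ‖(m : Euc n)‖ ^ 2) * (1 - ‖(m' : Euc n)‖ ^ 2)) =
        ((Real.exp t - 1) / 2) ^ 2 / Real.exp t) := by
  set w := EuclideanGeometry.inversion (ξ : Euc n) 1 m with hw
  set w' := EuclideanGeometry.inversion (ξ : Euc n) 1 m' with hw'
  have hy := Real.exp_pos (busemann ξ (m : Euc n))
  have ht := Real.exp_pos t
  set k := (Real.exp t - 1) / 2 * horoHeight ξ w with hk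
  have hky : k = (Real.exp t - 1) / 2 * Real.exp (busemann ξ (m : Euc n)) := by
    rw [hk, hw, horoHeight_inversion]
  -- The distance from `w'` to the flowed point depends only on `|w - w'|` and the two heights; both
  -- are fixed by the invariants in the statement.
  have key : ‖w' - horoAffine ξ t w‖ ^ 2 =
      ‖w - w'‖ ^ 2 + k * (horoHeight ξ w - horoHeight ξ w') + k ^ 2 := by
    have : w' - horoAffine ξ t w = -(w - w') + k • (ξ : Euc n) := by
      rw [horoAffine, hk]; abel
    rw [this, norm_add_sq_real, norm_neg, norm_smul, mem_sphere_zero_iff_norm.1 ξ.2, mul_one,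
      Real.norm_eq_abs, sq_abs, inner_smul_right, inner_neg_left, inner_sub_left, horoHeight,
      horoHeight, real_inner_comm, real_inner_comm w']
    ring
  rw [hw, hw', horoHeight_inversion, horoHeight_inversion, ← hw, ← hw'] at key
  have hiff : m' = horoFlow ξ t m ↔ ‖w' - horoAffine ξ t w‖ ^ 2 = 0 := by
    rw [sq_eq_zero_iff, norm_eq_zero, sub_eq_zero, Subtype.ext_iff]
    simp only [horoFlow, horoMap, ← hw]
    rw [← (EuclideanGeometry.inversion_injective (ξ : Euc n) one_ne_zero).eq_iff,
      EuclideanGeometry.inversion_inversion (ξ : Euc n) one_ne_zero]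
  have hsep : Real.exp (busemann ξ m') = Real.exp t * Real.exp (busemann ξ m) →
      (‖(m : Euc n) - m'‖ ^ 2 / ((1 - ‖(m : Euc n)‖ ^ 2) * (1 - ‖(m' : Euc n)‖ ^ 2)) =
        ((Real.exp t - 1) / 2) ^ 2 / Real.exp t ↔ ‖w' - horoAffine ξ t w‖ ^ 2 = 0) := by
    intro hs
    rw [norm_sub_sq_eq_inversion ξ, key, hs, hky, div_eq_div_iff (by positivity) (by positivity)]
    constructor
    · intro h
      have : ‖w - w'‖ ^ 2 = ((Real.exp t - 1) / 2) ^ 2 * Real.exp (busemann ξ m) ^ 2 := by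
        refine mul_right_cancel₀ ht.ne' ?_
        rw [h]; ring
      rw [this]; ring
    · intro h
      have : ‖w - w'‖ ^ 2 = ((Real.exp t - 1) / 2) ^ 2 * Real.exp (busemann ξ m) ^ 2 := by
        linear_combination h
      rw [← hw, ← hw', this]; ring
  constructor
  · intro h
    have h1 : Real.exp (busemann ξ m') = Real.exp t * Real.exp (busemann ξ m) := by
      rw [h, exp_busemann_horoFlow]
    exact ⟨h1, (hsep h1).2 (hiff.1 h)⟩
  · rintro ⟨h1, h2⟩
    exact hiff.2 ((hsep h1).1 h2)

/-- Both conditions of `eq_horoFlow_iff` are invariant: `γ` preserves the two-point function and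
shifts the Busemann function by a constant, which multiplies both exponentials by the same factor.
-/
lemma horoFlow_smul {n : ℕ} (γ : hypIsom n) (ξ : BdrySphere n) (t : ℝ) (m : HypBall n) :
    γ • horoFlow ξ t m = horoFlow (γ • ξ) t (γ • m) := by
  obtain ⟨-, h2⟩ := (eq_horoFlow_iff ξ t m _).1 rfl
  refine (eq_horoFlow_iff _ _ _ _).2 ⟨?_, (isom_twoPoint γ _ _).trans h2⟩
  simp only [bdry_smul_def, ball_smul_def, busemann_bdryMap, Real.exp_sub, exp_busemann_horoFlow]
  ring

/-! ### Unit covectors as differentials of Busemann functions -/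

/-- The direction of the boundary point towards which a unit covector points. -/
def endVec {n : ℕ} (m : HypBall n) (ν : Euc n) : Euc n :=
  (2⁻¹ : ℝ) • ν + (1 - ‖(m : Euc n)‖ ^ 2)⁻¹ • (m : Euc n)

/-- The unit length condition rewritten for `e = endVec m ν`: it says precisely that `m + e / |e|²`
has norm 1. -/
lemma endVec_norm {n : ℕ} (v : UnitCotangent n) :
    (1 - ‖(v.1.1 : Euc n)‖ ^ 2) * ‖endVec v.1.1 v.1.2‖ ^ 2 =
      1 + 2 * inner ℝ (v.1.1 : Euc n) (endVec v.1.1 v.1.2) := by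
  have h := v.2
  have p := one_sub_sq_pos v.1.1
  rw [covectorNorm] at h
  have h2 : ‖v.1.2‖ ^ 2 = 4 / (1 - ‖(v.1.1 : Euc n)‖ ^ 2) ^ 2 := by
    rw [eq_div_iff (by positivity)]
    linear_combination 4 * ((1 - ‖(v.1.1 : Euc n)‖ ^ 2) / 2 * ‖v.1.2‖ + 1) * h
  rw [endVec, norm_add_sq_real, norm_smul, norm_smul, inner_add_right, inner_smul_right,
    inner_smul_left, inner_smul_right, inner_smul_right, real_inner_self_eq_norm_sq, mul_pow,
    mul_pow, h2, Real.norm_eq_abs, Real.norm_eq_abs, sq_abs, sq_abs, conj_trivial,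
    real_inner_comm]
  field_simp
  ring

lemma endVec_ne_zero {n : ℕ} (v : UnitCotangent n) : endVec v.1.1 v.1.2 ≠ 0 := by
  intro h
  have := endVec_norm v
  rw [h] at this
  simp at this

/-- The boundary point towards which a unit covector points. -/
def endpoint {n : ℕ} (v : UnitCotangent n) : BdrySphere n :=
  ⟨(v.1.1 : Euc n) + (‖endVec v.1.1 v.1.2‖ ^ 2)⁻¹ • endVec v.1.1 v.1.2, by
    have h := endVec_norm v
    have h0 := norm_pos_iff.2 (endVec_ne_zero v)
    rw [mem_sphere_zero_iff_norm, ← sq_eq_sq₀ (norm_nonneg _) zero_le_one, norm_add_sq_real,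
      norm_smul, inner_smul_right, Real.norm_of_nonneg (by positivity)]
    field_simp
    linarith⟩

/-- The map `e ↦ e / |e|²` sends this vector to `ξ - m`, so `endpoint` recovers `ξ`. -/
lemma endVec_busemannCovector {n : ℕ} (ξ : BdrySphere n) (m : HypBall n) :
    endVec m (gradient (busemann ξ) (m : Euc n)) =
      -((‖(m : Euc n) - ξ‖ ^ 2)⁻¹ • ((m : Euc n) - ξ)) := by
  have h1 := one_sub_sq_pos m
  have h2 := sphere_sub_ball_pos ξ m
  rw [endVec, (hasGradientAt_busemann ξ m).gradient]
  match_scalars <;> field_simp <;> ring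

@[simp] lemma endpoint_busemannCovector {n : ℕ} (ξ : BdrySphere n) (m : HypBall n) :
    endpoint (busemannCovector ξ m) = ξ := by
  have h2 := sphere_sub_ball_pos ξ m
  refine Subtype.ext ?_
  simp only [endpoint, busemannCovector, endVec_busemannCovector]
  rw [norm_neg, norm_smul, Real.norm_of_nonneg (by positivity)]
  match_scalars <;> field_simp <;> ring

@[simp] lemma busemannCovector_endpoint {n : ℕ} (v : UnitCotangent n) :
    busemannCovector (endpoint v) v.1.1 = v := by
  have h0 := norm_pos_iff.2 (endVec_ne_zero v)
  have hsub : (v.1.1 : Euc n) - (endpoint v : Euc n) =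
      -((‖endVec v.1.1 v.1.2‖ ^ 2)⁻¹ • endVec v.1.1 v.1.2) := by
    simp only [endpoint]; abel
  refine Subtype.ext (Prod.ext rfl ?_)
  simp only [busemannCovector]
  rw [(hasGradientAt_busemann _ _).gradient, hsub, norm_neg, norm_smul,
    Real.norm_of_nonneg (by positivity)]
  set N := ‖endVec v.1.1 v.1.2‖ with hN
  have e : (2 / ((N ^ 2)⁻¹ * N) ^ 2) • -((N ^ 2)⁻¹ • endVec v.1.1 v.1.2) =
      (-2 : ℝ) • endVec v.1.1 v.1.2 := by
    match_scalars; field_simp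
  rw [e, endVec]
  match_scalars <;> ring

lemma continuous_gradient_busemann (n : ℕ) :
    Continuous fun p : HypBall n × BdrySphere n => gradient (busemann p.2) (p.1 : Euc n) := by
  have e : (fun p : HypBall n × BdrySphere n => gradient (busemann p.2) (p.1 : Euc n)) =
      fun p => -(2 / (1 - ‖(p.1 : Euc n)‖ ^ 2)) • (p.1 : Euc n) -
        (2 / ‖(p.1 : Euc n) - p.2‖ ^ 2) • ((p.1 : Euc n) - p.2) :=
    funext fun p => (hasGradientAt_busemann p.2 p.1).gradient
  rw [e]
  have h1 : ∀ p : HypBall n × BdrySphere n, 1 - ‖(p.1 : Euc n)‖ ^ 2 ≠ 0 := fun p =>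
    (one_sub_sq_pos p.1).ne'
  have h2 : ∀ p : HypBall n × BdrySphere n, ‖(p.1 : Euc n) - p.2‖ ^ 2 ≠ 0 := fun p =>
    (pow_pos (sphere_sub_ball_pos p.2 p.1) 2).ne'
  fun_prop (disch := assumption)

/-- Unit covectors correspond to pairs of a base point and a boundary point. -/
def covectorHomeo (n : ℕ) : HypBall n × BdrySphere n ≃ₜ UnitCotangent n where
  toFun p := busemannCovector p.2 p.1
  invFun v := (v.1.1, endpoint v)
  left_inv p := Prod.ext rfl (endpoint_busemannCovector p.2 p.1)
  right_inv v := by simp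
  continuous_toFun :=
    (continuous_fst.prodMk (continuous_gradient_busemann n)).subtype_mk _
  continuous_invFun := by
    refine (continuous_fst.comp continuous_subtype_val).prodMk ?_
    have h1 : ∀ v : UnitCotangent n, 1 - ‖(v.1.1 : Euc n)‖ ^ 2 ≠ 0 := fun v =>
      (one_sub_sq_pos v.1.1).ne'
    have hend : Continuous fun v : UnitCotangent n => endVec v.1.1 v.1.2 := by
      unfold endVec
      fun_prop (disch := assumption)
    have h2 : ∀ v : UnitCotangent n, ‖endVec v.1.1 v.1.2‖ ^ 2 ≠ 0 := fun v =>
      pow_ne_zero 2 (norm_ne_zero_iff.2 (endVec_ne_zero v))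
    refine Continuous.subtype_mk ?_ _
    fun_prop (disch := assumption)

/-- Isometries map differentials of Busemann functions to such. -/
lemma adjoint_fderiv_isomExt {n : ℕ} (γ : hypIsom n) (ξ : BdrySphere n) (m : HypBall n) :
    ContinuousLinearMap.adjoint (fderiv ℝ (isomExt γ) (m : Euc n))
      (gradient (busemann (γ • ξ)) ((γ • m : HypBall n) : Euc n)) =
      gradient (busemann ξ) (m : Euc n) := by
  obtain ⟨L, hL⟩ := hasFDerivAt_isomExt γ m
  have h1 := (hasGradientAt_busemann (γ • ξ) (γ • m)).differentiableAt.hasGradientAt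
  rw [hasGradientAt_iff_hasFDerivAt] at h1
  have hγ : isomExt γ m = ((γ • m : HypBall n) : Euc n) := isomExt_coe γ m
  rw [← hγ] at h1
  have h2 := h1.comp (m : Euc n) hL
  have h3 : HasGradientAt (busemann ξ) (ContinuousLinearMap.adjoint (fderiv ℝ (isomExt γ) (m : Euc n))
      (gradient (busemann (γ • ξ)) ((γ • m : HypBall n) : Euc n))) (m : Euc n) := by
    rw [hasGradientAt_iff_hasFDerivAt]
    have h4 := h2.add_const (Real.log (bdryDeriv γ ξ))
    -- Near `m` the functions `φ_ξ` and `φ_{γξ} ∘ γ` differ by a constant, so they have the same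
    -- gradient; the chain rule supplies the adjoint.
    have ev : busemann ξ =ᶠ[𝓝 (m : Euc n)]
        fun x => (busemann (γ • ξ) ∘ isomExt γ) x + Real.log (bdryDeriv γ ξ) := by
      filter_upwards [Metric.isOpen_ball.mem_nhds m.2] with x hx
      have := busemann_bdryMap γ ξ ⟨x, hx⟩
      rw [← isomExt_coe] at this
      simp only [Function.comp_apply, bdry_smul_def, this, sub_add_cancel]
    refine (h4.congr_of_eventuallyEq ev).congr_fderiv ?_
    ext v
    rw [InnerProductSpace.toDual_apply_apply, ContinuousLinearMap.adjoint_inner_left, hL.fderiv,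
      ContinuousLinearMap.comp_apply, InnerProductSpace.toDual_apply_apply, hγ]
  exact h3.gradient.symm

lemma gradient_busemann_injective {n : ℕ} {ξ η : BdrySphere n} (m : HypBall n)
    (h : gradient (busemann ξ) (m : Euc n) = gradient (busemann η) (m : Euc n)) : ξ = η := by
  have h6 : busemannCovector ξ m = busemannCovector η m := by
    unfold busemannCovector
    congr 2
  have := congrArg endpoint h6
  rwa [endpoint_busemannCovector, endpoint_busemannCovector] at this

lemma adjoint_fderiv_isomExt_injective {n : ℕ} (γ : hypIsom n) (m : HypBall n) :
    Function.Injective (ContinuousLinearMap.adjoint (fderiv ℝ (isomExt γ) (m : Euc n))) := by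
  intro z z' h
  obtain ⟨L, hL⟩ := hasFDerivAt_isomExt γ m
  have hρ := confFactor_pos γ (Metric.ball_subset_closedBall m.2)
  refine ext_inner_right ℝ fun v => ?_
  have h5 := congrArg (fun z => inner ℝ z ((confFactor γ m)⁻¹ • L.symm v)) h
  simp only [ContinuousLinearMap.adjoint_inner_left, hL.fderiv] at h5
  simpa [smul_smul, hρ.ne'] using h5

/-- The pull-back of `dφ_{γξ}` is `dφ_ξ`, pull-back is injective, and a covector determines its
boundary point. -/
lemma cotangentRel_busemannCovector_iff {n : ℕ} (Γ : Subgroup (hypIsom n)) (m m' : HypBall n)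
    (ξ η : BdrySphere n) :
    CotangentRel Γ (busemannCovector ξ m) (busemannCovector η m') ↔
      ∃ γ ∈ Γ, γ • m = m' ∧ γ • ξ = η := by
  unfold CotangentRel busemannCovector
  simp only [← ball_smul_def]
  refine exists_congr fun γ => and_congr_right fun _ => and_congr_right fun hm => ?_
  subst hm
  rw [← adjoint_fderiv_isomExt γ ξ m, (adjoint_fderiv_isomExt_injective γ m).eq_iff]
  exact ⟨gradient_busemann_injective _, fun h => by rw [h]⟩

/-- Covectors are identified in `S*M` if and only if the corresponding pairs of points are in the
same orbit. -/
lemma cotangentRel_iff {n : ℕ} (Γ : Subgroup (hypIsom n)) (p q : HypBall n × BdrySphere n) :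
    CotangentRel Γ (covectorHomeo n p) (covectorHomeo n q) ↔ ∃ γ : Γ, γ • p = q := by
  refine (cotangentRel_busemannCovector_iff Γ p.1 q.1 p.2 q.2).trans ?_
  simp only [Subtype.exists, Prod.ext_iff, Prod.smul_fst, Prod.smul_snd, Subgroup.mk_smul,
    exists_prop]

/-- The projection of pairs of a base point and a boundary point to `S*M`. -/
def quotProj {n : ℕ} (Γ : Subgroup (hypIsom n)) (p : HypBall n × BdrySphere n) :
    QuotCotangent Γ := toQuotCotangent Γ (busemannCovector p.2 p.1)

/-- `Quot` divides by the generated equivalence relation. Since the relation is already one,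
equality in `S*M` yields a group element. -/
lemma cotangentRel_equivalence {n : ℕ} (Γ : Subgroup (hypIsom n)) :
    Equivalence (CotangentRel Γ) := by
  have h : ∀ v w, CotangentRel Γ v w ↔
      ∃ γ : Γ, γ • (covectorHomeo n).symm v = (covectorHomeo n).symm w := fun v w => by
    rw [← cotangentRel_iff, Homeomorph.apply_symm_apply, Homeomorph.apply_symm_apply]
  refine ⟨fun v => (h v v).2 ⟨1, one_smul _ _⟩, fun {v w} hvw => ?_, fun {u v w} huv hvw => ?_⟩
  · obtain ⟨γ, hγ⟩ := (h v w).1 hvw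
    exact (h w v).2 ⟨γ⁻¹, by rw [← hγ, inv_smul_smul]⟩
  · obtain ⟨γ, hγ⟩ := (h u v).1 huv
    obtain ⟨δ, hδ⟩ := (h v w).1 hvw
    exact (h u w).2 ⟨δ * γ, by rw [mul_smul, hγ, hδ]⟩

lemma quotProj_eq_iff {n : ℕ} (Γ : Subgroup (hypIsom n)) (p q : HypBall n × BdrySphere n) :
    quotProj Γ p = quotProj Γ q ↔ ∃ γ : Γ, γ • p = q := by
  rw [← cotangentRel_iff]
  exact Quot.eq.trans (cotangentRel_equivalence Γ).eqvGen_iff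

lemma isQuotientMap_quotProj {n : ℕ} (Γ : Subgroup (hypIsom n)) : IsQuotientMap (quotProj Γ) :=
  (isQuotientMap_quot_mk (r := CotangentRel Γ)).comp (covectorHomeo n).isQuotientMap

instance continuousConstSMul_subgroup {n : ℕ} (Γ : Subgroup (hypIsom n)) :
    ContinuousConstSMul Γ (HypBall n × BdrySphere n) where
  continuous_const_smul γ :=
    ((continuous_const_smul (γ : hypIsom n)).comp continuous_fst).prodMk
      ((continuous_const_smul (γ : hypIsom n)).comp continuous_snd)

lemma ker_quotProj {n : ℕ} (Γ : Subgroup (hypIsom n)) :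
    Setoid.ker (quotProj Γ) = MulAction.orbitRel Γ (HypBall n × BdrySphere n) := by
  ext p q
  rw [Setoid.ker_def, eq_comm, quotProj_eq_iff, MulAction.orbitRel_apply, MulAction.mem_orbit_iff]

/-- `S*M` is the orbit space of pairs of a base point and a boundary point. -/
def quotHomeo {n : ℕ} (Γ : Subgroup (hypIsom n)) :
    Quotient (Setoid.ker (quotProj Γ)) ≃ₜ QuotCotangent Γ :=
  IsQuotientMap.homeomorph (f := ⟨quotProj Γ, (isQuotientMap_quotProj Γ).continuous⟩)
    (isQuotientMap_quotProj Γ)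

/-- The saturation of an open set is a union of translates of it. -/
lemma isOpenQuotientMap_quotProj {n : ℕ} (Γ : Subgroup (hypIsom n)) :
    IsOpenQuotientMap (quotProj Γ) := by
  refine ⟨(isQuotientMap_quotProj Γ).surjective, (isQuotientMap_quotProj Γ).continuous,
    fun U hU => ?_⟩
  rw [← (isQuotientMap_quotProj Γ).isOpen_preimage]
  have : quotProj Γ ⁻¹' (quotProj Γ '' U) = ⋃ γ : Γ, (fun p => γ • p) ⁻¹' U := by
    ext p
    simp only [mem_preimage, mem_image, mem_iUnion]
    constructor
    · rintro ⟨q, hq, h⟩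
      obtain ⟨γ, rfl⟩ := (quotProj_eq_iff Γ p q).1 h.symm
      exact ⟨γ, hq⟩
    · rintro ⟨γ, h⟩
      exact ⟨_, h, ((quotProj_eq_iff Γ _ _).2 ⟨γ, rfl⟩).symm⟩
  rw [this]
  exact isOpen_iUnion fun γ => hU.preimage (continuous_const_smul γ)

instance locallyCompactSpace_ball (n : ℕ) : LocallyCompactSpace (HypBall n) :=
  Metric.isOpen_ball.locallyCompactSpace

instance locallyCompactSpace_quotCotangent {n : ℕ} (Γ : Subgroup (hypIsom n)) :
    LocallyCompactSpace (QuotCotangent Γ) :=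
  (isOpenQuotientMap_quotProj Γ).locallyCompactSpace

instance secondCountableTopology_quotCotangent {n : ℕ} (Γ : Subgroup (hypIsom n)) :
    SecondCountableTopology (QuotCotangent Γ) :=
  (isQuotientMap_quotProj Γ).secondCountableTopology (isOpenQuotientMap_quotProj Γ).isOpenMap

/-- Projecting compact sets of pairs to the ball shows that the action on pairs is properly
discontinuous too, so its orbit space is Hausdorff. -/
lemma t2Space_quotCotangent {n : ℕ} {Γ : Subgroup (hypIsom n)}
    (hΓ : ProperlyDiscontinuousSMul Γ (HypBall n)) : T2Space (QuotCotangent Γ) := by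
  have : ProperlyDiscontinuousSMul Γ (HypBall n × BdrySphere n) :=
    ⟨fun {K L} hK hL => by
      refine (hΓ.finite_disjoint_inter_image (hK.image continuous_fst)
        (hL.image continuous_fst)).subset fun γ hγ => ?_
      obtain ⟨q, ⟨p, hp, rfl⟩, hq⟩ := hγ
      exact ⟨γ • p.1, ⟨_, ⟨p, hp, rfl⟩, rfl⟩, ⟨_, hq, rfl⟩⟩⟩
  have h : T2Space (Quotient (Setoid.ker (quotProj Γ))) := by
    rw [ker_quotProj]
    exact t2Space_of_properlyDiscontinuousSMul_of_t2Space
  exact (quotHomeo Γ).t2Space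

/-! ### The geodesic flow of the quotient -/

lemma continuous_horoFlow (n : ℕ) (t : ℝ) :
    Continuous fun p : HypBall n × BdrySphere n => horoFlow p.2 t p.1 := by
  refine Continuous.subtype_mk (f := fun p : HypBall n × BdrySphere n => horoMap p.2 t p.1) ?_ _
  have h1 : Continuous fun p : HypBall n × BdrySphere n => (p.2 : Euc n) := by fun_prop
  have h2 : Continuous fun p : HypBall n × BdrySphere n =>
      EuclideanGeometry.inversion (p.2 : Euc n) 1 p.1 :=
    h1.inversion continuous_const (by fun_prop) fun p => ball_ne_sphere p.2 p.1
  refine h1.inversion continuous_const ?_ fun p => ne_of_horoHeight_pos (horoHeight_pos _ _ _)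
  unfold horoAffine horoHeight
  fun_prop

/-- The representative chosen by `Quot.out` differs from `p` by some `γ`, which `horoFlow_smul`
carries through the flow. -/
lemma quotFlow_quotProj {n : ℕ} (Γ : Subgroup (hypIsom n)) (t : ℝ) (p : HypBall n × BdrySphere n) :
    quotFlow Γ t (quotProj Γ p) = quotProj Γ (horoFlow p.2 t p.1, p.2) := by
  set v := Quot.out (quotProj Γ p) with hv
  have h1 : toQuotCotangent Γ v = quotProj Γ p := Quot.out_eq _
  have h2 : v = covectorHomeo n ((covectorHomeo n).symm v) := by simp
  set q := (covectorHomeo n).symm v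
  have h3 : quotProj Γ p = quotProj Γ q := by rw [← h1, h2]; rfl
  obtain ⟨γ, hγ⟩ := (quotProj_eq_iff Γ p q).1 h3
  have h4 : quotFlow Γ t (quotProj Γ p) = quotProj Γ (horoFlow q.2 t q.1, q.2) := by
    rw [quotFlow, ← hv, h2]
    exact congrArg (toQuotCotangent Γ) (geodesicFlow_busemannCovector q.2 t q.1)
  rw [h4, eq_comm, quotProj_eq_iff]
  refine ⟨γ, ?_⟩
  rw [← hγ]
  exact Prod.ext (horoFlow_smul (γ : hypIsom n) p.2 t p.1) rfl

lemma continuous_quotFlow {n : ℕ} (Γ : Subgroup (hypIsom n)) (t : ℝ) :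
    Continuous (quotFlow Γ t) := by
  rw [(isQuotientMap_quotProj Γ).continuous_iff]
  refine ((isQuotientMap_quotProj Γ).continuous.comp
    ((continuous_horoFlow n t).prodMk continuous_snd)).congr fun p => ?_
  exact (quotFlow_quotProj Γ t p).symm

/-! ### Invariant measures -/

lemma abs_det_smul_linearIsometryEquiv {n : ℕ} (r : ℝ) (L : Euc n ≃ₗᵢ[ℝ] Euc n) :
    |(r • (L : Euc n →L[ℝ] Euc n)).det| = |r| ^ (n + 1) := by
  have h := LinearMap.normDet_smul L.toLinearIsometry.toLinearMap r
  rw [L.toLinearIsometry.normDet_eq_one, mul_one, LinearMap.normDet_eq_abs_det] at h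
  rw [Real.norm_eq_abs, finrank_euclideanSpace_fin] at h
  exact h

/-- A bijection of the ball whose Jacobian determinant is the quotient of values of the density `w`
preserves the measure with density `w`. -/
lemma measurePreserving_of_abs_det {n : ℕ} {Φ : HypBall n → HypBall n} (hΦ : Function.Bijective Φ)
    (hm : Measurable Φ) {G : Euc n → Euc n} {G' : Euc n → Euc n →L[ℝ] Euc n}
    (hG : ∀ m : HypBall n, G m = Φ m) (hder : ∀ m : HypBall n, HasFDerivAt G (G' m) (m : Euc n))
    {w : Euc n → ENNReal}
    (hw : ∀ m : HypBall n, ENNReal.ofReal |(G' m).det| * w (Φ m) = w m) :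
    MeasurePreserving Φ
      ((Measure.comap (Subtype.val : HypBall n → Euc n) volume).withDensity fun m => w m)
      ((Measure.comap (Subtype.val : HypBall n → Euc n) volume).withDensity fun m => w m) := by
  refine ⟨hm, Measure.ext fun s hs => ?_⟩
  have hball : MeasurableSet (Metric.ball (0 : Euc n) 1) := Metric.isOpen_ball.measurableSet
  have himg : ∀ {t : Set (HypBall n)}, MeasurableSet t →
      MeasurableSet ((Subtype.val : HypBall n → Euc n) '' t) := fun ht =>
    (MeasurableEmbedding.subtype_coe hball).measurableSet_image.2 ht
  rw [Measure.map_apply hm hs, withDensity_apply _ (hm hs), withDensity_apply _ hs,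
    setLIntegral_subtype hball _ w, setLIntegral_subtype hball _ w]
  have hs' : (Subtype.val : HypBall n → Euc n) '' s =
      G '' ((Subtype.val : HypBall n → Euc n) '' (Φ ⁻¹' s)) := by
    rw [image_image]
    simp_rw [hG]
    rw [← image_image Subtype.val Φ, image_preimage_eq _ hΦ.surjective]
  have hinj : InjOn G ((Subtype.val : HypBall n → Euc n) '' (Φ ⁻¹' s)) := by
    rintro _ ⟨p, -, rfl⟩ _ ⟨q, -, rfl⟩ h
    rw [hG, hG] at h
    exact congrArg _ (hΦ.injective (Subtype.ext h))
  rw [hs', lintegral_image_eq_lintegral_abs_det_fderiv_mul volume (himg (hm hs))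
    (f' := G') (by rintro _ ⟨p, -, rfl⟩; exact (hder p).hasFDerivWithinAt) hinj]
  refine setLIntegral_congr_fun (himg (hm hs)) ?_
  rintro _ ⟨p, -, rfl⟩
  simp only
  rw [hG, hw]

lemma bijective_smul_ball {n : ℕ} (γ : hypIsom n) :
    Function.Bijective fun m : HypBall n => γ • m := MulAction.bijective γ

/-- Isometries preserve the hyperbolic volume. -/
lemma measurePreserving_isom {n : ℕ} (γ : hypIsom n) :
    MeasurePreserving (fun m : HypBall n => γ • m) (hypVol n) (hypVol n) := by
  refine measurePreserving_of_abs_det (G := isomExt γ) (G' := fun m => fderiv ℝ (isomExt γ) m)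
    (w := fun m => ENNReal.ofReal ((2 / (1 - ‖m‖ ^ 2)) ^ (n + 1)))
    (bijective_smul_ball γ) (continuous_const_smul γ).measurable (fun m => isomExt_coe γ m)
    (fun m => (hasFDerivAt_isomExt γ m).choose_spec.differentiableAt.hasFDerivAt) fun m => ?_
  obtain ⟨L, hL⟩ := hasFDerivAt_isomExt γ m
  have hm := Metric.ball_subset_closedBall m.2
  have hρ := confFactor_pos γ hm
  have p := one_sub_sq_pos m
  have hγ : isomExt γ m = ((γ • m : HypBall n) : Euc n) := isomExt_coe γ m
  rw [hL.fderiv, abs_det_smul_linearIsometryEquiv, ← ENNReal.ofReal_mul (by positivity), ← hγ,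
    one_sub_norm_isomExt_sq γ hm, abs_of_pos hρ, ← mul_pow]
  congr 2
  field_simp

instance smulInvariantMeasure_hypVol {n : ℕ} (Γ : Subgroup (hypIsom n)) :
    SMulInvariantMeasure Γ (HypBall n) (hypVol n) where
  measure_preimage_smul γ _ hs :=
    (measurePreserving_isom (γ : hypIsom n)).measure_preimage hs.nullMeasurableSet

instance measurableConstSMul_ball {n : ℕ} (Γ : Subgroup (hypIsom n)) :
    MeasurableConstSMul Γ (HypBall n) where
  measurable_const_smul γ := (continuous_const_smul (γ : hypIsom n)).measurable

lemma bijective_horoFlow {n : ℕ} (ξ : BdrySphere n) (t : ℝ) :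
    Function.Bijective (horoFlow ξ t) :=
  Function.bijective_iff_has_inverse.2
    ⟨horoFlow ξ (-t), horoFlow_neg_horoFlow ξ t, horoFlow_horoFlow_neg ξ t⟩

lemma continuous_horoFlow_right {n : ℕ} (ξ : BdrySphere n) (t : ℝ) : Continuous (horoFlow ξ t) :=
  Continuous.comp (g := fun p : HypBall n × BdrySphere n => horoFlow p.2 t p.1)
    (f := fun m => (m, ξ)) (continuous_horoFlow n t) (by fun_prop)

/-- The derivative of the geodesic flow towards `ξ` in the half space model. -/
def horoAffineDeriv {n : ℕ} (ξ : BdrySphere n) (t : ℝ) : Euc n →L[ℝ] Euc n :=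
  ContinuousLinearMap.id ℝ _ + ((Real.exp t - 1) • innerSL ℝ (ξ : Euc n)).smulRight (ξ : Euc n)

/-- A rank-one perturbation of the identity: it stretches only the direction of `ξ`, by `exp t`. -/
lemma det_horoAffineDeriv {n : ℕ} (ξ : BdrySphere n) (t : ℝ) :
    (horoAffineDeriv ξ t).det = Real.exp t := by
  have h : ((horoAffineDeriv ξ t : Euc n →L[ℝ] Euc n) : Euc n →ₗ[ℝ] Euc n) =
      LinearMap.transvection ((Real.exp t - 1) • (innerSL ℝ (ξ : Euc n) : Euc n →ₗ[ℝ] ℝ)) ξ := by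
    ext1 v
    simp [horoAffineDeriv, LinearMap.transvection.apply]
  rw [ContinuousLinearMap.det, h, LinearMap.transvection.det]
  simp

lemma hasFDerivAt_horoAffine {n : ℕ} (ξ : BdrySphere n) (t : ℝ) (w : Euc n) :
    HasFDerivAt (horoAffine ξ t) (horoAffineDeriv ξ t) w := by
  have h1 := (innerSL ℝ (ξ : Euc n)).hasFDerivAt (x := w)
  have h2 := (hasFDerivAt_id w).fun_sub
    ((((h1.const_mul 2).const_sub 1).const_mul ((Real.exp t - 1) / 2)).smul_const (ξ : Euc n))
  refine h2.congr_fderiv ?_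
  ext1 v
  simp [horoAffineDeriv]
  match_scalars <;> ring

lemma hasFDerivAt_horoMap {n : ℕ} (ξ : BdrySphere n) (t : ℝ) (m : HypBall n) :
    ∃ L L' : Euc n ≃ₗᵢ[ℝ] Euc n, HasFDerivAt (horoMap ξ t)
      (((‖(horoFlow ξ t m : Euc n) - ξ‖ ^ 2) • (L : Euc n →L[ℝ] Euc n)) ∘L (horoAffineDeriv ξ t) ∘L
        ((1 / ‖(m : Euc n) - ξ‖ ^ 2) • (L' : Euc n →L[ℝ] Euc n))) (m : Euc n) := by
  have h1 := EuclideanGeometry.hasFDerivAt_inversion (R := 1) (ball_ne_sphere ξ m)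
  set w := EuclideanGeometry.inversion (ξ : Euc n) 1 m
  have h2 := EuclideanGeometry.hasFDerivAt_inversion (R := 1)
    (ne_of_horoHeight_pos (horoHeight_pos ξ m t))
  have h3 := EuclideanGeometry.dist_inversion_center (ξ : Euc n) (horoAffine ξ t w) 1
  have h4 : dist (EuclideanGeometry.inversion (ξ : Euc n) 1 (horoAffine ξ t w)) ξ =
    ‖(horoFlow ξ t m : Euc n) - ξ‖ := dist_eq_norm _ _
  rw [h4, one_pow] at h3
  rw [← h3] at h2
  rw [dist_eq_norm, div_pow, one_pow] at h1
  have h5 := (hasFDerivAt_horoAffine ξ t w).comp (m : Euc n) h1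
  exact ⟨_, _, HasFDerivAt.comp (m : Euc n) h2 h5⟩

lemma continuous_busemann {n : ℕ} (ξ : BdrySphere n) :
    Continuous fun m : HypBall n => busemann ξ (m : Euc n) :=
  continuous_iff_continuousAt.2 fun m =>
    (hasGradientAt_busemann ξ m).differentiableAt.continuousAt.comp
      continuous_subtype_val.continuousAt

/-- Merges the two densities into one with respect to Lebesgue measure, the form needed for
`measurePreserving_of_abs_det`. -/
lemma hypVol_withDensity {n : ℕ} (ξ : BdrySphere n) (c : ℝ) :
    (hypVol n).withDensity (fun m => ENNReal.ofReal (Real.exp (n * (busemann ξ (m : Euc n) + c)))) =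
      (Measure.comap (Subtype.val : HypBall n → Euc n) volume).withDensity fun m =>
        ENNReal.ofReal ((2 / (1 - ‖(m : Euc n)‖ ^ 2)) ^ (n + 1) *
          Real.exp (n * (busemann ξ (m : Euc n) + c))) := by
  have h1 : Continuous fun m : HypBall n => (2 / (1 - ‖(m : Euc n)‖ ^ 2)) ^ (n + 1) := by
    have : ∀ m : HypBall n, 1 - ‖(m : Euc n)‖ ^ 2 ≠ 0 := fun m => (one_sub_sq_pos m).ne'
    fun_prop (disch := assumption)
  have h2 := continuous_busemann ξ
  have h3 : Continuous fun m : HypBall n => Real.exp (n * (busemann ξ (m : Euc n) + c)) :=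
    Real.continuous_exp.comp (continuous_const.mul (h2.add continuous_const))
  rw [hypVol, ← withDensity_mul _ h1.measurable.ennreal_ofReal h3.measurable.ennreal_ofReal]
  congr 1
  funext m
  have := one_sub_sq_pos m
  rw [Pi.mul_apply, ENNReal.ofReal_mul (by positivity)]

/-- The flow towards `ξ` preserves the measure `exp (n (φ_ξ + c)) dVol`. -/
lemma measurePreserving_horoFlow {n : ℕ} (ξ : BdrySphere n) (c t : ℝ) :
    MeasurePreserving (horoFlow ξ t)
      ((hypVol n).withDensity
        (fun m => ENNReal.ofReal (Real.exp (n * (busemann ξ (m : Euc n) + c)))))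
      ((hypVol n).withDensity
        (fun m => ENNReal.ofReal (Real.exp (n * (busemann ξ (m : Euc n) + c))))) := by
  rw [hypVol_withDensity]
  refine measurePreserving_of_abs_det (G := horoMap ξ t) (G' := fun m => fderiv ℝ (horoMap ξ t) m)
    (w := fun m => ENNReal.ofReal ((2 / (1 - ‖m‖ ^ 2)) ^ (n + 1) *
          Real.exp (n * (busemann ξ m + c))))
    (bijective_horoFlow ξ t) (continuous_horoFlow_right ξ t).measurable (fun m => rfl)
    (fun m => by
      obtain ⟨L, L', h⟩ := hasFDerivAt_horoMap ξ t m
      exact h.differentiableAt.hasFDerivAt) fun m => ?_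
  obtain ⟨L, L', h⟩ := hasFDerivAt_horoMap ξ t m
  have hdet : |(fderiv ℝ (horoMap ξ t) (m : Euc n)).det| =
      (‖(horoFlow ξ t m : Euc n) - ξ‖ ^ 2) ^ (n + 1) * Real.exp t *
        (1 / ‖(m : Euc n) - ξ‖ ^ 2) ^ (n + 1) := by
    have e1 := abs_det_smul_linearIsometryEquiv (‖(horoFlow ξ t m : Euc n) - ξ‖ ^ 2) L
    have e2 := abs_det_smul_linearIsometryEquiv (1 / ‖(m : Euc n) - ξ‖ ^ 2) L'
    have e3 := det_horoAffineDeriv ξ t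
    rw [abs_of_nonneg (sq_nonneg ‖(horoFlow ξ t m : Euc n) - ξ‖)] at e1
    rw [abs_of_nonneg (div_nonneg zero_le_one (sq_nonneg ‖(m : Euc n) - ξ‖))] at e2
    have e4 : ∀ A B : Euc n →L[ℝ] Euc n, (A ∘L B).det = A.det * B.det := fun A B =>
      LinearMap.det_comp (A : Euc n →ₗ[ℝ] Euc n) (B : Euc n →ₗ[ℝ] Euc n)
    rw [h.fderiv, e4, e4, abs_mul, abs_mul, e1, e2, e3, abs_of_pos (Real.exp_pos t), mul_assoc]
  have p1 := one_sub_sq_pos m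
  have p2 := one_sub_sq_pos (horoFlow ξ t m)
  have q1 := sphere_sub_ball_pos ξ m
  have q2 := sphere_sub_ball_pos ξ (horoFlow ξ t m)
  have hexp : ∀ p : HypBall n, Real.exp (n * (busemann ξ (p : Euc n) + c)) =
      Real.exp (busemann ξ (p : Euc n)) ^ n * Real.exp (n * c) := fun p => by
    rw [← Real.exp_nat_mul, ← Real.exp_add, mul_add]
  -- The density becomes a constant times `exp (-φ_ξ(p)) |p - ξ|^(-2(n+1))`. The powers of the
  -- distances cancel against the two inversions, and the `exp t` of the Jacobian against the growth
  -- of `exp φ_ξ`.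
  have hden : ∀ p : HypBall n, 2 / (1 - ‖(p : Euc n)‖ ^ 2) =
      2 / (Real.exp (busemann ξ (p : Euc n)) * ‖(p : Euc n) - ξ‖ ^ 2) := fun p => by
    have := sphere_sub_ball_pos ξ p
    rw [exp_busemann]
    field_simp
  rw [← ENNReal.ofReal_mul (by positivity), hdet, hexp, hexp, hden, hden, exp_busemann_horoFlow]
  congr 1
  simp only [div_pow, mul_pow, one_pow]
  field_simp
  ring

/-! ### Convergence of the Poincaré series -/

/-- The points of the ball that are close to the sphere. -/
def ballShell (n : ℕ) (h : ℝ) : Set (Euc n) := {x | ‖x‖ < 1 ∧ 1 - ‖x‖ ^ 2 < h}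

lemma measureReal_closedBall {n : ℕ} {r : ℝ} (hr : 0 ≤ r) :
    volume.real (Metric.closedBall (0 : Euc n) r) =
      r ^ (n + 1) * volume.real (Metric.ball (0 : Euc n) 1) := by
  rw [Measure.real, Measure.addHaar_closedBall _ _ hr, ENNReal.toReal_mul,
    ENNReal.toReal_ofReal (by positivity), finrank_euclideanSpace_fin, Measure.real]

lemma ballShell_subset_ball (n : ℕ) (h : ℝ) : ballShell n h ⊆ Metric.ball 0 1 := fun _ hx =>
  mem_ball_zero_iff.2 hx.1

/-- The shell misses the closed ball of radius `1 - h`, whose volume Bernoulli's inequality bounds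
from below. -/
lemma measureReal_ballShell_le (n : ℕ) {h : ℝ} (h0 : 0 < h) (h1 : h ≤ 1) :
    volume.real (ballShell n h) ≤ (n + 1) * h * volume.real (Metric.ball (0 : Euc n) 1) := by
  have hdisj : Disjoint (ballShell n h) (Metric.closedBall 0 (1 - h)) := by
    rw [Set.disjoint_left]
    intro x hx hx'
    rw [mem_closedBall_zero_iff] at hx'
    have := hx.2
    nlinarith [norm_nonneg x]
  have hle : volume.real (ballShell n h ∪ Metric.closedBall (0 : Euc n) (1 - h)) ≤
      volume.real (Metric.ball (0 : Euc n) 1) := by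
    refine measureReal_mono (union_subset (ballShell_subset_ball n h)
      (Metric.closedBall_subset_ball (by linarith))) measure_ball_lt_top.ne
  have hfin : volume (ballShell n h) ≠ ⊤ :=
    ((measure_mono (ballShell_subset_ball n h)).trans_lt measure_ball_lt_top).ne
  rw [measureReal_union hdisj Metric.isClosed_closedBall.measurableSet hfin
    (measure_closedBall_lt_top).ne,
    measureReal_closedBall (by linarith)] at hle
  have hb := one_add_mul_le_pow (a := -h) (by linarith) (n + 1)
  push_cast at hb
  have hV : 0 ≤ volume.real (Metric.ball (0 : Euc n) 1) := measureReal_nonneg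
  have e : (1 + -h) = 1 - h := by ring
  rw [e] at hb
  nlinarith [mul_le_mul_of_nonneg_right hb hV]

/-- Near a boundary point the shells have volume at least proportional to their thickness. -/
lemma exists_le_measureReal_shell {n : ℕ} (ξ : BdrySphere n) {r : ℝ} (hr : 0 < r) :
    ∃ c > 0, ∃ h₀ > 0, ∀ h, 0 < h → h ≤ h₀ →
      c * h ≤ volume.real {x : Euc n | ‖x - ξ‖ < r ∧ x ∈ ballShell n h} := by
  have hξ : ‖(ξ : Euc n)‖ = 1 := mem_sphere_zero_iff_norm.1 ξ.2
  -- An open cone around the ray through `ξ`; its pieces scale exactly.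
  set C : Set (Euc n) := {x | ‖x - ‖x‖ • (ξ : Euc n)‖ < r / 2 * ‖x‖} with hC
  have hCopen : IsOpen C := isOpen_lt (by fun_prop) (by fun_prop)
  have hCo : IsOpen (C ∩ Metric.ball 0 1) := hCopen.inter Metric.isOpen_ball
  have hne : (C ∩ Metric.ball 0 1).Nonempty := by
    refine ⟨(2⁻¹ : ℝ) • (ξ : Euc n), ?_, ?_⟩
    · simp only [hC, mem_ofPred_eq, norm_smul, hξ]
      norm_num
      linarith
    · rw [mem_ball_zero_iff, norm_smul, hξ]; norm_num
  have hfin : volume (C ∩ Metric.ball (0 : Euc n) 1) ≠ ⊤ :=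
    ((measure_mono inter_subset_right).trans_lt measure_ball_lt_top).ne
  have hpos : 0 < volume.real (C ∩ Metric.ball (0 : Euc n) 1) :=
    ENNReal.toReal_pos (hCo.measure_pos volume hne).ne' hfin
  refine ⟨volume.real (C ∩ Metric.ball (0 : Euc n) 1) / 4, by positivity, min r 1, by positivity,
    fun h h0 hle => ?_⟩
  have hr' : h ≤ r := hle.trans (min_le_left _ _)
  have h1' : h ≤ 1 := hle.trans (min_le_right _ _)
  -- Points with `k ≤ |x| < 1` satisfy `1 - |x|² < h`, and those in the cone are within `r` of `ξ`
  -- since `h ≤ r`. This piece of the cone has relative volume `1 - k^(n+1) ≥ h / 4`.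
  set k := 1 - h / 4 with hk
  have hk0 : 0 < k := by linarith
  have hscale : k • (C ∩ Metric.ball (0 : Euc n) 1) = C ∩ Metric.ball 0 k := by
    ext x
    rw [mem_smul_set_iff_inv_smul_mem₀ hk0.ne', mem_inter_iff, mem_inter_iff, mem_ball_zero_iff,
      mem_ball_zero_iff, norm_smul, Real.norm_of_nonneg (by positivity)]
    simp only [hC, mem_ofPred_eq, norm_smul, Real.norm_of_nonneg (inv_nonneg.2 hk0.le), mul_smul,
      ← smul_sub]
    refine and_congr ?_ ?_
    · rw [show r / 2 * (k⁻¹ * ‖x‖) = k⁻¹ * (r / 2 * ‖x‖) by ring,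
        mul_lt_mul_iff_right₀ (inv_pos.2 hk0)]
    · rw [inv_mul_lt_iff₀ hk0, mul_one]
  have hvol : volume.real (C ∩ Metric.ball (0 : Euc n) k) =
      k ^ (n + 1) * volume.real (C ∩ Metric.ball (0 : Euc n) 1) := by
    rw [← hscale, Measure.real, Measure.addHaar_smul, ENNReal.toReal_mul,
      ENNReal.toReal_ofReal (by positivity), abs_of_nonneg (by positivity),
      finrank_euclideanSpace_fin, Measure.real]
  have hsub : (C ∩ Metric.ball (0 : Euc n) 1) \ (C ∩ Metric.ball 0 k) ⊆
      {x : Euc n | ‖x - ξ‖ < r ∧ x ∈ ballShell n h} := by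
    rintro x ⟨⟨hxC, hx1⟩, hx2⟩
    have hxk : k ≤ ‖x‖ := by
      by_contra hlt
      exact hx2 ⟨hxC, mem_ball_zero_iff.2 (not_le.1 hlt)⟩
    rw [mem_ball_zero_iff] at hx1
    refine ⟨?_, hx1, ?_⟩
    · have e : x - ξ = (x - ‖x‖ • (ξ : Euc n)) + (‖x‖ - 1) • (ξ : Euc n) := by
        rw [sub_smul, one_smul]; abel
      have h2 : ‖(‖x‖ - 1) • (ξ : Euc n)‖ = 1 - ‖x‖ := by
        rw [norm_smul, hξ, mul_one, Real.norm_eq_abs, abs_of_nonpos (by linarith)]; ring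
      have h3 : ‖x - ‖x‖ • (ξ : Euc n)‖ < r / 2 * ‖x‖ := hxC
      rw [e]
      refine (norm_add_le _ _).trans_lt ?_
      rw [h2]
      nlinarith
    · nlinarith
  have hfin2 : volume {x : Euc n | ‖x - ξ‖ < r ∧ x ∈ ballShell n h} ≠ ⊤ :=
    ((measure_mono fun x hx => ballShell_subset_ball n h hx.2).trans_lt measure_ball_lt_top).ne
  refine le_trans ?_ (measureReal_mono hsub hfin2)
  rw [measureReal_sdiff (inter_subset_inter_right _ (Metric.ball_subset_ball (by linarith)))
    (hCopen.inter Metric.isOpen_ball).measurableSet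
    ((measure_mono inter_subset_right).trans_lt measure_ball_lt_top).ne, hvol]
  have hkN : k ^ (n + 1) ≤ k := by
    rw [pow_succ]
    exact mul_le_of_le_one_left hk0.le (pow_le_one₀ hk0.le (by linarith))
  nlinarith

lemma orbit_dist_pos {n : ℕ} {Γ : Subgroup (hypIsom n)} {ξ : BdrySphere n}
    (hξ : ξ ∈ discontinuitySet Γ) :
    ∃ δ > 0, ∀ γ : Γ, δ ≤ ‖((γ • ballOrigin n : HypBall n) : Euc n) - ξ‖ := by
  have h : (ξ : Euc n) ∉
    closure (range fun γ : Γ => ((γ • ballOrigin n : HypBall n) : Euc n)) := hξ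
  rw [Metric.mem_closure_iff] at h
  push Not at h
  obtain ⟨δ, hδ, h⟩ := h
  exact ⟨δ, hδ, fun γ => by
    have := h _ ⟨γ, rfl⟩
    rwa [dist_comm, dist_eq_norm] at this⟩

lemma isomCenter_eq {n : ℕ} (γ : hypIsom n) : isomCenter γ = γ⁻¹ • ballOrigin n := rfl

/-- The Poincaré series converges at the exponent `n`. -/
lemma summable_poincare {n : ℕ} {Γ : Subgroup (hypIsom n)} (D : OutgoingData Γ)
    {ξ : BdrySphere n} (hξ : ξ ∈ discontinuitySet Γ) :
    Summable fun γ : Γ => (1 - ‖((γ • ballOrigin n : HypBall n) : Euc n)‖ ^ 2) ^ n := by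
  obtain ⟨δ, hδ, hδΓ⟩ := orbit_dist_pos hξ
  obtain ⟨r₀, hr₀, hU⟩ := D.U_diagonal ξ hξ
  set r := min r₀ (δ / 2) with hr
  have hrpos : 0 < r := by positivity
  obtain ⟨c, hc, h₀, hh₀, hshell⟩ := exists_le_measureReal_shell ξ hrpos
  -- The conformal factor of `γ` near `ξ` is comparable to `e γ`, which involves `γ⁻¹ 0`; the sum is
  -- reindexed by inversion at the end.
  set e : Γ → ℝ := fun γ => 1 - ‖(isomCenter (γ : hypIsom n) : Euc n)‖ ^ 2 with he
  have hepos : ∀ γ, 0 < e γ := fun γ => one_sub_sq_pos _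
  set V := volume.real (Metric.ball (0 : Euc n) 1) with hV
  set d := (δ / 2) ^ 2 with hd
  have hdpos : 0 < d := by positivity
  set K := (n + 1) * V * (5 ^ (n + 1) / (c * d)) with hK
  have hmain : ∀ S : Finset Γ, ∑ γ ∈ S, e γ ^ n ≤ K := by
    intro S
    -- The thickness `h` may depend on the finite set `S`, because it cancels from the final bound
    -- `K`.
    obtain ⟨h, hh0, hh1, hhS⟩ : ∃ h : ℝ, 0 < h ∧ h ≤ 1 ∧ ∀ γ ∈ S, h * d / e γ ≤ h₀ := by
      have ev : ∀ᶠ h in 𝓝[>] (0 : ℝ), h ≤ 1 ∧ ∀ γ ∈ S, h * d / e γ ≤ h₀ := by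
        refine (eventually_nhdsWithin_of_eventually_nhds (eventually_le_nhds one_pos)).and ?_
        rw [Filter.eventually_all_finset]
        intro γ _
        refine eventually_nhdsWithin_of_eventually_nhds ?_
        have : Continuous fun h : ℝ => h * d / e γ := by fun_prop
        refine (this.tendsto 0).eventually (eventually_le_nhds (by simpa using hh₀))
      obtain ⟨h, ⟨h1, h2⟩, h3⟩ := (ev.and self_mem_nhdsWithin).exists
      exact ⟨h, h3, h1, h2⟩
    -- The thickness is adapted to `γ`: multiplied by the largest possible conformal factor `e γ /
    -- d` it gives `h`, so all images lie in one shell of thickness `h`.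
    let W : Γ → Set (Euc n) := fun γ => {x | ‖x - ξ‖ < r ∧ x ∈ ballShell n (h * d / e γ)}
    have hWb : ∀ γ, W γ ⊆ Metric.ball 0 1 := fun γ x hx => ballShell_subset_ball n _ hx.2
    have hWm : ∀ γ, MeasurableSet (W γ) := fun γ => by
      have o1 : IsOpen {x : Euc n | ‖x - ξ‖ < r} := isOpen_lt (by fun_prop) (by fun_prop)
      have o2 : IsOpen {x : Euc n | ‖x‖ < 1} := isOpen_lt (by fun_prop) (by fun_prop)
      have o3 : IsOpen {x : Euc n | 1 - ‖x‖ ^ 2 < h * d / e γ} :=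
        isOpen_lt (by fun_prop) (by fun_prop)
      exact (o1.inter (o2.inter o3)).measurableSet
    have hinj : ∀ γ : Γ, InjOn (isomExt (γ : hypIsom n)) (W γ) := fun γ x hx y hy hxy => by
      have h1 := isomExt_coe (γ : hypIsom n) ⟨x, hWb γ hx⟩
      have h2 := isomExt_coe (γ : hypIsom n) ⟨y, hWb γ hy⟩
      have := (Equiv.injective (γ : Equiv.Perm (HypBall n)))
        (Subtype.ext (h1.symm.trans (hxy.trans h2)))
      exact congrArg Subtype.val this
    have hder : ∀ γ : Γ, ∀ x ∈ W γ, HasFDerivWithinAt (isomExt (γ : hypIsom n))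
        (fderiv ℝ (isomExt (γ : hypIsom n)) x) (W γ) x := fun γ x hx =>
      (hasFDerivAt_isomExt (γ : hypIsom n)
        ⟨x, hWb γ hx⟩).choose_spec.differentiableAt.hasFDerivAt.hasFDerivWithinAt
    -- The denominator of the factor is at most `1 + 4 = 5`. It is at least `d = (δ / 2)²`, because
    -- `γ⁻¹ 0` is at distance at least `δ` from `ξ` and `x` is within `δ / 2` of it.
    have hρ : ∀ γ : Γ, ∀ x ∈ W γ, e γ / 5 ≤ confFactor (γ : hypIsom n) x ∧
        confFactor (γ : hypIsom n) x ≤ e γ / d := fun γ x hx => by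
      have hx1 : ‖x‖ < 1 := hx.2.1
      have he1 : e γ ≤ 1 := by
        have := sq_nonneg ‖(isomCenter (γ : hypIsom n) : Euc n)‖
        simp only [he]; linarith
      have ha1 : ‖(isomCenter (γ : hypIsom n) : Euc n)‖ < 1 := mem_ball_zero_iff.1 (isomCenter _).2
      have hp : 0 ≤ 1 - ‖x‖ ^ 2 := by nlinarith [norm_nonneg x]
      have h1 := hδΓ γ⁻¹
      have h1' : δ ≤ ‖(isomCenter (γ : hypIsom n) : Euc n) - ξ‖ := h1
      have h2 : ‖(isomCenter (γ : hypIsom n) : Euc n) - ξ‖ ≤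
          ‖x - isomCenter (γ : hypIsom n)‖ + ‖x - ξ‖ := by
        rw [norm_sub_rev x]
        exact norm_sub_le_norm_sub_add_norm_sub _ _ _
      have h3 : ‖x - ξ‖ < δ / 2 := hx.1.trans_le (min_le_right _ _)
      have h4 : δ / 2 ≤ ‖x - isomCenter (γ : hypIsom n)‖ := by linarith
      have h5 : ‖x - isomCenter (γ : hypIsom n)‖ ≤ 2 :=
        (norm_sub_le _ _).trans (by linarith)
      have h6 : d ≤ ‖x - isomCenter (γ : hypIsom n)‖ ^ 2 :=
        pow_le_pow_left₀ (by positivity) h4 2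
      have h7 : 0 ≤ (1 - ‖x‖ ^ 2) * e γ := mul_nonneg hp (hepos γ).le
      have h8 : (1 - ‖x‖ ^ 2) * e γ ≤ 1 := by nlinarith [sq_nonneg ‖x‖, hepos γ]
      have h9 : ‖x - isomCenter (γ : hypIsom n)‖ ^ 2 ≤ 4 := by
        nlinarith [norm_nonneg (x - isomCenter (γ : hypIsom n))]
      exact ⟨div_le_div_of_nonneg_left (hepos γ).le (by linarith) (by linarith),
        div_le_div_of_nonneg_left (hepos γ).le hdpos (by linarith)⟩
    have himg : ∀ γ : Γ, isomExt (γ : hypIsom n) '' W γ ⊆ ballShell n h := by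
      rintro γ _ ⟨x, hx, rfl⟩
      have h1 := one_sub_norm_isomExt_sq (γ : hypIsom n)
        (Metric.ball_subset_closedBall (hWb γ hx))
      have hm := ((γ : Equiv.Perm (HypBall n)) ⟨x, hWb γ hx⟩).2
      rw [← isomExt_coe, mem_ball_zero_iff] at hm
      refine ⟨hm, ?_⟩
      have hx1 : ‖x‖ < 1 := hx.2.1
      have hp : 0 ≤ 1 - ‖x‖ ^ 2 := by nlinarith [norm_nonneg x]
      have hlt : 1 - ‖x‖ ^ 2 < h * d / e γ := hx.2.2
      have hed : 0 < e γ / d := div_pos (hepos γ) hdpos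
      rw [h1]
      calc _ ≤ e γ / d * (1 - ‖x‖ ^ 2) := mul_le_mul_of_nonneg_right (hρ γ x hx).2 hp
        _ < e γ / d * (h * d / e γ) := mul_lt_mul_of_pos_left hlt hed
        _ = h := by have := (hepos γ).ne'; field_simp
    have hfin : ∀ {s : Set (Euc n)}, s ⊆ Metric.ball 0 1 → volume s ≠ ⊤ := fun hs =>
      ((measure_mono hs).trans_lt measure_ball_lt_top).ne
    have hvol : ∀ γ ∈ S, c * d / 5 ^ (n + 1) * h * e γ ^ n ≤
        volume.real (isomExt (γ : hypIsom n) '' W γ) := fun γ hγ => by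
      have h1 := lintegral_image_eq_lintegral_abs_det_fderiv_mul volume (hWm γ) (hder γ) (hinj γ)
        (fun _ => 1)
      rw [setLIntegral_one] at h1
      have h2 : ENNReal.ofReal ((e γ / 5) ^ (n + 1)) * volume (W γ) ≤
          volume (isomExt (γ : hypIsom n) '' W γ) := by
        rw [h1, ← setLIntegral_const]
        refine setLIntegral_mono' (hWm γ) fun x hx => ?_
        obtain ⟨L, hL⟩ := hasFDerivAt_isomExt (γ : hypIsom n) ⟨x, hWb γ hx⟩
        have hpos := confFactor_pos (γ : hypIsom n) (Metric.ball_subset_closedBall (hWb γ hx))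
        rw [hL.fderiv, abs_det_smul_linearIsometryEquiv, mul_one, abs_of_pos hpos]
        refine ENNReal.ofReal_le_ofReal (pow_le_pow_left₀ ?_ (hρ γ x hx).1 _)
        have := hepos γ
        positivity
      have h3 := ENNReal.toReal_mono (hfin ((himg γ).trans (ballShell_subset_ball n h))) h2
      have := hepos γ
      rw [ENNReal.toReal_mul, ENNReal.toReal_ofReal (by positivity)] at h3
      have h4 := hshell (h * d / e γ) (by positivity) (hhS γ hγ)
      calc _ = (e γ / 5) ^ (n + 1) * (c * (h * d / e γ)) := by
            rw [div_pow, pow_succ (e γ)]; field_simp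
        _ ≤ (e γ / 5) ^ (n + 1) * volume.real (W γ) :=
            mul_le_mul_of_nonneg_left h4 (by positivity)
        _ ≤ _ := h3
    -- An overlap would give two points of the slice over `ξ` in one orbit, so the two group
    -- elements coincide by injectivity of the projection on the slice.
    have hdisj : (S : Set Γ).Pairwise (Function.onFun Disjoint fun γ =>
        isomExt (γ : hypIsom n) '' W γ) := by
      intro γ _ γ' _ hne
      rw [Function.onFun, Set.disjoint_left]
      rintro _ ⟨x, hx, rfl⟩ ⟨y, hy, hxy⟩
      refine hne ?_
      have h1 := isomExt_coe (γ : hypIsom n) ⟨x, hWb γ hx⟩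
      have h2 := isomExt_coe (γ' : hypIsom n) ⟨y, hWb γ' hy⟩
      have h3 : γ' • (⟨y, hWb γ' hy⟩ : HypBall n) = γ • (⟨x, hWb γ hx⟩ : HypBall n) :=
        Subtype.ext (h2.symm.trans (hxy.trans h1))
      have h4 : (γ'⁻¹ * γ) • (⟨x, hWb γ hx⟩ : HypBall n) = ⟨y, hWb γ' hy⟩ := by
        rw [mul_smul, ← h3, inv_smul_smul]
      have hlt : ∀ {z : Euc n}, ‖z - ξ‖ < r → ‖z - ξ‖ < r₀ := fun hz =>
        hz.trans_le (min_le_left _ _)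
      have u1 := hU ⟨x, hWb γ hx⟩ ξ (hlt hx.1) (by simpa using hr₀)
      have u2 := hU ⟨y, hWb γ' hy⟩ ξ (hlt hy.1) (by simpa using hr₀)
      rw [← h4] at u2
      have := D.U_injective (γ'⁻¹ * γ : Γ) (γ'⁻¹ * γ).2 _ ξ u1 u2
      have h5 : γ'⁻¹ * γ = 1 := Subtype.ext this
      exact (inv_mul_eq_one.1 h5).symm
    have hmeas : ∀ γ ∈ S, MeasurableSet (isomExt (γ : hypIsom n) '' W γ) := fun γ _ =>
      measurable_image_of_fderivWithin (hWm γ) (hder γ) (hinj γ)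
    have hunion : ∑ γ ∈ S, volume.real (isomExt (γ : hypIsom n) '' W γ) ≤
        (n + 1) * h * V := by
      rw [← measureReal_biUnion_finset hdisj hmeas
        (fun γ _ => hfin ((himg γ).trans (ballShell_subset_ball n h)))]
      refine (measureReal_mono (iUnion₂_subset fun γ _ => himg γ)
        (hfin (ballShell_subset_ball n h))).trans (measureReal_ballShell_le n hh0 hh1)
    have hsum := (Finset.sum_le_sum hvol).trans hunion
    rw [← Finset.mul_sum] at hsum
    have hq : 0 < c * d / 5 ^ (n + 1) * h := by positivity
    rw [← le_div_iff₀' hq] at hsum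
    refine hsum.trans (le_of_eq ?_)
    rw [hK]
    field_simp
  have hs : Summable fun γ : Γ => e γ ^ n :=
    summable_of_sum_le (fun γ => pow_nonneg (hepos γ).le n) hmain
  have := (Equiv.inv Γ).summable_iff.2 hs
  refine this.congr fun γ => ?_
  simp only [Function.comp_apply, Equiv.inv_apply, he, isomCenter_eq]
  simp only [InvMemClass.coe_inv, inv_inv]
  rfl

/-- Harnack inequality for the Busemann functions. -/
lemma exp_busemann_smul_le {n : ℕ} (γ : hypIsom n) (ξ : BdrySphere n) (m : HypBall n) :
    Real.exp (busemann ξ ((γ • m : HypBall n) : Euc n)) ≤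
      (1 + ‖(m : Euc n)‖) / (1 - ‖(m : Euc n)‖) *
        Real.exp (busemann ξ ((γ • ballOrigin n : HypBall n) : Euc n)) := by
  -- By equivariance the ratio of the two values is `exp φ_η(m)`, because `φ_η` vanishes at the
  -- origin.
  set η := γ⁻¹ • ξ with hη
  have h1 := busemann_bdryMap γ η m
  have h2 := busemann_bdryMap γ η (ballOrigin n)
  have h3 : bdryMap γ η = ξ := smul_inv_smul γ ξ
  have h4 : busemann η (ballOrigin n : Euc n) = 0 := by
    simp [busemann]
  rw [h3] at h1 h2
  rw [h4] at h2
  have h5 : busemann ξ ((γ • m : HypBall n) : Euc n) =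
      busemann η m + busemann ξ ((γ • ballOrigin n : HypBall n) : Euc n) := by
    rw [ball_smul_def, ball_smul_def, h1, h2]; ring
  rw [h5, Real.exp_add]
  refine mul_le_mul_of_nonneg_right ?_ (Real.exp_pos _).le
  rw [exp_busemann]
  have hm : ‖(m : Euc n)‖ < 1 := mem_ball_zero_iff.1 m.2
  have hη1 : ‖(η : Euc n)‖ = 1 := mem_sphere_zero_iff_norm.1 η.2
  have h6 : 1 - ‖(m : Euc n)‖ ≤ ‖(m : Euc n) - η‖ := by
    have := norm_sub_norm_le (η : Euc n) m
    rwa [hη1, norm_sub_rev] at this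
  have h7 : (1 - ‖(m : Euc n)‖) ^ 2 ≤ ‖(m : Euc n) - η‖ ^ 2 :=
    pow_le_pow_left₀ (by linarith) h6 2
  have h8 : 0 < 1 - ‖(m : Euc n)‖ := by linarith
  rw [div_le_div_iff₀ (pow_pos (sphere_sub_ball_pos η m) 2) h8]
  calc (1 - ‖(m : Euc n)‖ ^ 2) * (1 - ‖(m : Euc n)‖)
      = (1 + ‖(m : Euc n)‖) * (1 - ‖(m : Euc n)‖) ^ 2 := by ring
    _ ≤ _ := mul_le_mul_of_nonneg_left h7 (by positivity)

/-- Sums of Poisson kernels over orbits converge, uniformly on compact sets. -/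
lemma exists_tsum_exp_busemann_le {n : ℕ} {Γ : Subgroup (hypIsom n)} (D : OutgoingData Γ)
    {ξ : BdrySphere n} (hξ : ξ ∈ discontinuitySet Γ) :
    ∃ S : ℝ, 0 ≤ S ∧ ∀ m : HypBall n,
      (Summable fun γ : Γ => Real.exp (n * busemann ξ ((γ • m : HypBall n) : Euc n))) ∧
      ∑' γ : Γ, Real.exp (n * busemann ξ ((γ • m : HypBall n) : Euc n)) ≤
        ((1 + ‖(m : Euc n)‖) / (1 - ‖(m : Euc n)‖)) ^ n * S := by
  obtain ⟨δ, hδ, hδΓ⟩ := orbit_dist_pos hξ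
  have hs := (summable_poincare D hξ).mul_left ((δ ^ 2)⁻¹ ^ n)
  refine ⟨∑' γ : Γ, (δ ^ 2)⁻¹ ^ n * (1 - ‖((γ • ballOrigin n : HypBall n) : Euc n)‖ ^ 2) ^ n,
    tsum_nonneg fun γ => mul_nonneg (by positivity) (pow_nonneg (one_sub_sq_pos _).le _),
    fun m => ?_⟩
  have hm : ‖(m : Euc n)‖ < 1 := mem_ball_zero_iff.1 m.2
  have hm' : 0 < 1 - ‖(m : Euc n)‖ := by linarith
  have hle : ∀ γ : Γ, Real.exp (n * busemann ξ ((γ • m : HypBall n) : Euc n)) ≤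
      ((1 + ‖(m : Euc n)‖) / (1 - ‖(m : Euc n)‖)) ^ n *
        ((δ ^ 2)⁻¹ ^ n * (1 - ‖((γ • ballOrigin n : HypBall n) : Euc n)‖ ^ 2) ^ n) := fun γ => by
    have h1 := exp_busemann_smul_le (γ : hypIsom n) ξ m
    -- The orbit stays at distance `δ` from `ξ`, so the Poisson kernel is at most `δ⁻²` times its
    -- numerator.
    have h2 : Real.exp (busemann ξ ((γ • ballOrigin n : HypBall n) : Euc n)) ≤
        (δ ^ 2)⁻¹ * (1 - ‖((γ • ballOrigin n : HypBall n) : Euc n)‖ ^ 2) := by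
      rw [exp_busemann, div_eq_inv_mul]
      refine mul_le_mul_of_nonneg_right ?_ (one_sub_sq_pos _).le
      exact inv_anti₀ (by positivity) (pow_le_pow_left₀ hδ.le (hδΓ γ) 2)
    rw [Real.exp_nat_mul, ← mul_pow, ← mul_pow]
    refine pow_le_pow_left₀ (Real.exp_pos _).le (h1.trans ?_) n
    exact mul_le_mul_of_nonneg_left h2 (by positivity)
  have hs' := hs.mul_left (((1 + ‖(m : Euc n)‖) / (1 - ‖(m : Euc n)‖)) ^ n)
  have hsum := Summable.of_nonneg_of_le (fun γ => (Real.exp_pos _).le) hle hs'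
  refine ⟨hsum, ?_⟩
  rw [← tsum_mul_left]
  exact hsum.tsum_le_tsum hle hs'

/-! ### The outgoing region -/

/-- A positive function that tends to zero and whose critical points are strict maxima decreases
eventually. -/
lemma eventually_deriv_nonpos {f : ℝ → ℝ} (hf : ContDiff ℝ 2 f) (hpos : ∀ t, 0 < f t)
    (hlim : Tendsto f atTop (𝓝 0)) {T : ℝ}
    (hcrit : ∀ t, T ≤ t → deriv f t = 0 → deriv (deriv f) t < 0) :
    ∀ᶠ t in atTop, deriv f t ≤ 0 := by
  have hf1 : Differentiable ℝ f := hf.differentiable (by norm_num)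
  have hg : ContDiff ℝ 1 (deriv f) := by
    have : ContDiff ℝ (1 + 1) f := by
      have e : (1 + 1 : WithTop ℕ∞) = 2 := by norm_num
      rwa [e]
    exact ((contDiff_succ_iff_deriv (n := 1)).1 this).2.2
  -- Once nonpositive, the derivative stays so, since it is strictly decreasing wherever it
  -- vanishes. If it were positive forever, `f` would increase from a positive value and could not
  -- tend to zero.
  by_cases h : ∃ t₁, T ≤ t₁ ∧ deriv f t₁ ≤ 0
  · obtain ⟨t₁, hT, h1⟩ := h
    filter_upwards [eventually_ge_atTop t₁] with t ht
    refine image_le_of_deriv_right_lt_deriv_boundary' (f := deriv f) (f' := deriv (deriv f))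
      (B := fun _ => 0) (B' := fun _ => 0) (a := t₁) (b := t) hg.continuous.continuousOn
      (fun x _ => (hg.differentiable (by norm_num) x).hasDerivAt.hasDerivWithinAt) h1
      continuousOn_const (fun x _ => hasDerivWithinAt_const _ _ _)
      (fun x hx h0 => hcrit x (hT.trans hx.1) h0) ⟨ht, le_rfl⟩
  · push Not at h
    exfalso
    have hmono : MonotoneOn f (Ici T) := by
      refine monotoneOn_of_deriv_nonneg (convex_Ici T) hf1.continuous.continuousOn
        hf1.differentiableOn fun x hx => ?_
      rw [interior_Ici] at hx
      exact (h x (le_of_lt hx)).le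
    have : f T ≤ 0 := by
      refine ge_of_tendsto hlim ?_
      filter_upwards [eventually_ge_atTop T] with t ht
      exact hmono self_mem_Ici ht ht
    exact absurd this (not_le.2 (hpos T))

lemma contDiff_horoFlow {n : ℕ} (ξ : BdrySphere n) (m : HypBall n) :
    ContDiff ℝ ∞ fun t => (horoFlow ξ t m : Euc n) := by
  refine contDiff_iff_contDiffAt.2 fun t => ?_
  refine ContDiffAt.inversion contDiffAt_const contDiffAt_const ?_
    (ne_of_horoHeight_pos (horoHeight_pos ξ m t))
  unfold horoAffine
  fun_prop

lemma OutgoingData.contDiffAt_x {n : ℕ} {Γ : Subgroup (hypIsom n)} (D : OutgoingData Γ)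
    (m : HypBall n) : ContDiffAt ℝ ∞ D.x (m : Euc n) :=
  D.x_smooth.contDiffAt (mem_of_superset (Metric.isOpen_ball.mem_nhds m.2) subset_union_left)

lemma geodesicFlow_busemannCovector_base {n : ℕ} (ξ : BdrySphere n) (t : ℝ) (m : HypBall n) :
    ((geodesicFlow t (busemannCovector ξ m)).1.1 : Euc n) = horoFlow ξ t m := by
  rw [geodesicFlow_busemannCovector]; rfl

/-- Every flow line enters the outgoing region. -/
lemma OutgoingData.eventually_mem_slice {n : ℕ} {Γ : Subgroup (hypIsom n)} (D : OutgoingData Γ)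
    {ξ : BdrySphere n} (hξ : ξ ∈ discontinuitySet Γ) (m : HypBall n) :
    ∀ᶠ t in atTop, horoFlow ξ t m ∈ D.slice ξ := by
  set f : ℝ → ℝ := fun t => D.x (horoFlow ξ t m : Euc n) with hf
  have hsmooth : ContDiff ℝ ∞ f := contDiff_iff_contDiffAt.2 fun t =>
    (D.contDiffAt_x (horoFlow ξ t m)).comp t (contDiff_horoFlow ξ m).contDiffAt
  have hlim : Tendsto f atTop (𝓝 0) := by
    rw [← D.x_bdry ξ hξ]
    have h1 := (D.x_smooth (ξ : Euc n) (Or.inr ⟨ξ, hξ, rfl⟩)).continuousWithinAt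
    exact h1.tendsto.comp (tendsto_nhdsWithin_iff.2
      ⟨tendsto_horoFlow ξ m, Eventually.of_forall fun t => Or.inl (horoFlow ξ t m).2⟩)
  -- The convexity condition and the slice refer to time 0; restarting the flow at time `t` turns
  -- them into statements about `f` at `t`.
  have hflow : ∀ t, (fun s => D.x ((geodesicFlow s (busemannCovector ξ (horoFlow ξ t m))).1.1 :
      Euc n)) = fun s => f (s + t) := fun t => by
    funext s
    rw [geodesicFlow_busemannCovector_base, ← horoFlow_add]
  have hε : ∀ᶠ t in atTop, f t ≤ D.ε₀ := hlim.eventually (eventually_le_nhds D.ε₀_pos)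
  obtain ⟨T, hT⟩ := eventually_atTop.1 hε
  have hderiv : ∀ t, deriv (fun s => f (s + t)) = fun s => deriv f (s + t) := fun t => by
    funext s
    rw [deriv_comp_add_const]
  have hcrit : ∀ t, T ≤ t → deriv f t = 0 → deriv (deriv f) t < 0 := fun t ht h0 => by
    have := D.x_convex (busemannCovector ξ (horoFlow ξ t m)) (hT t ht)
    rw [hflow, iteratedDeriv_succ, iteratedDeriv_one, hderiv, deriv_comp_add_const, zero_add]
      at this
    exact this (by simpa using h0)
  have hmono := eventually_deriv_nonpos (hsmooth.of_le (WithTop.coe_le_coe.2 le_top))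
    (fun t => D.x_pos _ (horoFlow ξ t m).2) hlim hcrit
  obtain ⟨r, hr, hU⟩ := D.U_diagonal ξ hξ
  have hnear : ∀ᶠ t in atTop, ‖(horoFlow ξ t m : Euc n) - ξ‖ < r := by
    have := (tendsto_horoFlow ξ m).eventually (Metric.ball_mem_nhds _ hr)
    filter_upwards [this] with t ht
    rwa [← dist_eq_norm]
  filter_upwards [hε, hmono, hnear] with t h1 h2 h3
  refine ⟨hU _ ξ h3 (by simpa using hr), h1, ?_⟩
  rw [hflow, hderiv]
  simpa using h2

/-- By the chain rule and Hamilton's equation `ẋ` is `dx` applied to a multiple of the gradient of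
`φ_ξ`, hence continuous in `m`; the slice is an open set cut by two closed conditions. -/
lemma OutgoingData.measurableSet_slice {n : ℕ} {Γ : Subgroup (hypIsom n)} (D : OutgoingData Γ)
    (ξ : BdrySphere n) : MeasurableSet (D.slice ξ) := by
  have hx : Continuous fun m : HypBall n => D.x (m : Euc n) :=
    continuous_iff_continuousAt.2 fun m =>
      (D.contDiffAt_x m).continuousAt.comp continuous_subtype_val.continuousAt
  have hdx : Continuous fun m : HypBall n => fderiv ℝ D.x (m : Euc n) :=
    continuous_iff_continuousAt.2 fun m =>
      ((D.contDiffAt_x m).fderiv_right (m := 0) (by simp)).continuousAt.comp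
        continuous_subtype_val.continuousAt
  have hν : Continuous fun m : HypBall n => gradient (busemann ξ) (m : Euc n) :=
    Continuous.comp (g := fun p : HypBall n × BdrySphere n => gradient (busemann p.2) (p.1 : Euc n))
      (f := fun m => (m, ξ)) (continuous_gradient_busemann n) (by fun_prop)
  have hder : ∀ m : HypBall n,
      deriv (fun t => D.x ((geodesicFlow t (busemannCovector ξ m)).1.1 : Euc n)) 0 =
        fderiv ℝ D.x (m : Euc n)
          ((((1 - ‖(m : Euc n)‖ ^ 2) / 2) ^ 2) • gradient (busemann ξ) (m : Euc n)) := fun m => by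
    have h1 := (isGeodesicOrbit_horoFlow ξ m 0).1
    rw [gradient_geodesicHamiltonian_right] at h1
    simp only [busemannCovector, horoFlow_zero] at h1
    have h2 := ((D.contDiffAt_x m).differentiableAt (by simp)).hasFDerivAt
    have h3 : (horoFlow ξ 0 m : Euc n) = m := by rw [horoFlow_zero]
    rw [← h3] at h2
    have h4 := h2.comp_hasDerivAt 0 h1
    rw [h3] at h4
    rw [← h4.deriv]
    congr 1
    funext t
    rw [geodesicFlow_busemannCovector_base]
    rfl
  have hU : MeasurableSet {m : HypBall n | (m, ξ) ∈ D.U} :=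
    (D.U_open.preimage (f := fun m : HypBall n => (m, ξ)) (by fun_prop)).measurableSet
  have h2 : MeasurableSet {m : HypBall n | D.x (m : Euc n) ≤ D.ε₀} :=
    (isClosed_le hx continuous_const).measurableSet
  have h3 : MeasurableSet {m : HypBall n |
      deriv (fun t => D.x ((geodesicFlow t (busemannCovector ξ m)).1.1 : Euc n)) 0 ≤ 0} := by
    simp_rw [hder]
    refine (isClosed_le (hdx.clm_apply ?_) continuous_const).measurableSet
    fun_prop
  exact hU.inter (h2.inter h3)

/-! ### The limiting measure -/

/-- Each set of a compact exhaustion of the ball receives the origin under finitely many group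
elements only. -/
lemma countable_of_properlyDiscontinuous {n : ℕ} {Γ : Subgroup (hypIsom n)}
    (hΓ : ProperlyDiscontinuousSMul Γ (HypBall n)) : Countable Γ := by
  have hcov : (univ : Set Γ) ⊆ ⋃ k : ℕ, {γ : Γ | (((fun m : HypBall n => γ • m) ''
      {ballOrigin n}) ∩ compactCovering (HypBall n) k).Nonempty} := fun γ _ => by
    obtain ⟨k, hk⟩ := mem_iUnion.1 ((iUnion_compactCovering (HypBall n)).ge
      (mem_univ (γ • ballOrigin n)))
    exact mem_iUnion.2 ⟨k, γ • ballOrigin n, ⟨_, rfl, rfl⟩, hk⟩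
  refine countable_univ_iff.1 ((countable_iUnion fun k => ?_).mono hcov)
  exact (hΓ.finite_disjoint_inter_image isCompact_singleton
    (isCompact_compactCovering (HypBall n) k)).countable

/-- The measure on the ball whose push-forward is the limiting measure. -/
def OutgoingData.horoMeasure {n : ℕ} {Γ : Subgroup (hypIsom n)} (D : OutgoingData Γ)
    (ξ : BdrySphere n) : Measure (HypBall n) :=
  (hypVol n).withDensity fun m => ENNReal.ofReal (Real.exp (n * D.phase ξ m))

/-- The projection of `m` to `S*M` along the differential of the Busemann function. -/
def busemannProj {n : ℕ} (Γ : Subgroup (hypIsom n)) (ξ : BdrySphere n) (m : HypBall n) :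
    QuotCotangent Γ := toQuotCotangent Γ (busemannCovector ξ m)

lemma busemannProj_eq {n : ℕ} (Γ : Subgroup (hypIsom n)) (ξ : BdrySphere n) (m : HypBall n) :
    busemannProj Γ ξ m = quotProj Γ (m, ξ) := rfl

lemma continuous_busemannProj {n : ℕ} (Γ : Subgroup (hypIsom n)) (ξ : BdrySphere n) :
    Continuous (busemannProj Γ ξ) :=
  Continuous.comp (g := quotProj Γ) (f := fun m => (m, ξ)) (isQuotientMap_quotProj Γ).continuous
    (by fun_prop)

lemma busemannProj_smul {n : ℕ} (Γ : Subgroup (hypIsom n)) (γ : Γ) (ξ : BdrySphere n)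
    (m : HypBall n) : busemannProj Γ (bdryMap γ ξ) m = busemannProj Γ ξ (γ⁻¹ • m) := by
  rw [busemannProj_eq, busemannProj_eq, quotProj_eq_iff]
  exact ⟨γ⁻¹, Prod.ext rfl (inv_smul_smul (γ : hypIsom n) ξ)⟩

lemma quotFlow_busemannProj {n : ℕ} (Γ : Subgroup (hypIsom n)) (t : ℝ) (ξ : BdrySphere n)
    (m : HypBall n) : quotFlow Γ t (busemannProj Γ ξ m) = busemannProj Γ ξ (horoFlow ξ t m) :=
  quotFlow_quotProj Γ t (m, ξ)

lemma continuous_exp_phase {n : ℕ} {Γ : Subgroup (hypIsom n)} (D : OutgoingData Γ)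
    (ξ : BdrySphere n) : Continuous fun m => Real.exp (n * D.phase ξ m) :=
  Real.continuous_exp.comp
    (continuous_const.mul ((continuous_busemann ξ).add continuous_const))

lemma OutgoingData.outgoingMeasure_eq {n : ℕ} {Γ : Subgroup (hypIsom n)} (D : OutgoingData Γ)
    (ξ : BdrySphere n) : D.outgoingMeasure ξ =
      ((D.horoMeasure ξ).restrict (D.slice ξ)).map (busemannProj Γ ξ) := by
  rw [horoMeasure, restrict_withDensity (D.measurableSet_slice ξ)]
  rfl

lemma hypVol_ball_lt_top (n : ℕ) {r : ℝ} (hr : r < 1) :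
    hypVol n {m : HypBall n | ‖(m : Euc n)‖ < r} < ⊤ := by
  have hball : MeasurableSet (Metric.ball (0 : Euc n) 1) := Metric.isOpen_ball.measurableSet
  have hB : MeasurableSet {m : HypBall n | ‖(m : Euc n)‖ < r} :=
    (isOpen_lt (by fun_prop) continuous_const).measurableSet
  rw [hypVol, withDensity_apply _ hB]
  refine (setLIntegral_mono' hB (g := fun _ => ENNReal.ofReal ((2 / (1 - r ^ 2)) ^ (n + 1)))
    fun m hm => ?_).trans_lt ?_
  · have hm' : ‖(m : Euc n)‖ < r := hm
    have h0 := norm_nonneg (m : Euc n)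
    have h1 : 0 < 1 - r ^ 2 := by nlinarith
    have h2 : 1 - r ^ 2 ≤ 1 - ‖(m : Euc n)‖ ^ 2 := by nlinarith
    have h3 := one_sub_sq_pos m
    exact ENNReal.ofReal_le_ofReal (pow_le_pow_left₀ (by positivity)
      (div_le_div_of_nonneg_left two_pos.le h1 h2) _)
  · rw [setLIntegral_const]
    refine ENNReal.mul_lt_top ENNReal.ofReal_lt_top ?_
    rw [(MeasurableEmbedding.subtype_coe hball).comap_apply]
    refine (measure_mono ?_).trans_lt (measure_ball_lt_top (x := (0 : Euc n)) (r := 1))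
    rintro _ ⟨m, -, rfl⟩
    exact m.2

/-- The projection is open, so images of the increasing sets of pairs over smaller balls form a
directed open cover. -/
lemma exists_subset_image_ball {n : ℕ} (Γ : Subgroup (hypIsom n)) {K : Set (QuotCotangent Γ)}
    (hK : IsCompact K) : ∃ r : ℝ, r < 1 ∧
      K ⊆ quotProj Γ '' {p | ‖(p.1 : Euc n)‖ < r} := by
  have hmono : Monotone fun r : Iio (1 : ℝ) =>
      quotProj Γ '' {p | ‖(p.1 : Euc n)‖ < r} := fun r s hrs =>
    image_mono fun p (hp : ‖(p.1 : Euc n)‖ < r) => hp.trans_le hrs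
  have : Nonempty (Iio (1 : ℝ)) := ⟨⟨0, mem_Iio.2 one_pos⟩⟩
  obtain ⟨r, hr⟩ := hK.elim_directed_cover _ (fun r : Iio (1 : ℝ) =>
    (isOpenQuotientMap_quotProj Γ).isOpenMap {p | ‖(p.1 : Euc n)‖ < r}
      (isOpen_lt (by fun_prop) continuous_const)) (fun z _ => by
      obtain ⟨p, rfl⟩ := (isQuotientMap_quotProj Γ).surjective z
      obtain ⟨r, h1, h2⟩ := exists_between (mem_ball_zero_iff.1 p.1.2)
      exact mem_iUnion.2 ⟨⟨r, h2⟩, p, h1, rfl⟩) hmono.directed_le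
  exact ⟨r, r.2, hr⟩

/-- The push-forward of the horospherical measure to `S*M` is finite on compact sets. -/
lemma OutgoingData.horoMeasure_preimage_lt_top {n : ℕ} {Γ : Subgroup (hypIsom n)}
    (hΓ : ProperlyDiscontinuousSMul Γ (HypBall n)) (D : OutgoingData Γ) {ξ : BdrySphere n}
    (hξ : ξ ∈ discontinuitySet Γ) {K : Set (QuotCotangent Γ)} (hK : IsCompact K) :
    D.horoMeasure ξ (busemannProj Γ ξ ⁻¹' K) < ⊤ := by
  have := countable_of_properlyDiscontinuous hΓ
  obtain ⟨r, hr1, hr⟩ := exists_subset_image_ball Γ hK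
  obtain ⟨S, hS0, hS⟩ := exists_tsum_exp_busemann_le D hξ
  set B := {m : HypBall n | ‖(m : Euc n)‖ < r} with hB
  have hBm : MeasurableSet B := (isOpen_lt (by fun_prop) continuous_const).measurableSet
  -- The preimage is covered by the translates of `B`. Pulled back to `B`, their masses add up to
  -- the integral of a sum of Poisson kernels, which is bounded on `B`.
  have hsub : busemannProj Γ ξ ⁻¹' K ⊆ ⋃ γ : Γ, (fun m : HypBall n => γ⁻¹ • m) ⁻¹' B := by
    intro m hm
    obtain ⟨p, hp, hpm⟩ := hr hm
    obtain ⟨γ, hγ⟩ := (quotProj_eq_iff Γ p (m, ξ)).1 hpm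
    refine mem_iUnion.2 ⟨γ, ?_⟩
    have : γ • p.1 = m := congrArg Prod.fst hγ
    rw [mem_preimage, ← this, inv_smul_smul]
    exact hp
  have hGm : Measurable fun m => ENNReal.ofReal (Real.exp (n * D.phase ξ m)) :=
    (continuous_exp_phase D ξ).measurable.ennreal_ofReal
  have hpiece : ∀ γ : Γ, D.horoMeasure ξ ((fun m : HypBall n => γ⁻¹ • m) ⁻¹' B) =
      ∫⁻ m in B, ENNReal.ofReal (Real.exp (n * D.phase ξ (γ • m))) ∂(hypVol n) := fun γ => by
    have hPm : MeasurableSet ((fun m : HypBall n => γ⁻¹ • m) ⁻¹' B) :=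
      measurable_const_smul γ⁻¹ hBm
    rw [horoMeasure, withDensity_apply _ hPm, ← lintegral_indicator hPm,
      ← (measurePreserving_isom (γ : hypIsom n)).lintegral_comp (hGm.indicator hPm),
      ← lintegral_indicator hBm]
    refine lintegral_congr fun m => ?_
    have hiff : (γ : hypIsom n) • m ∈ (fun m : HypBall n => γ⁻¹ • m) ⁻¹' B ↔ m ∈ B := by
      rw [mem_preimage]
      have : γ⁻¹ • ((γ : hypIsom n) • m) = m := inv_smul_smul γ m
      rw [this]
    by_cases hmB : m ∈ B
    · rw [indicator_of_mem (hiff.2 hmB), indicator_of_mem hmB]; rfl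
    · rw [indicator_of_notMem (mt hiff.1 hmB), indicator_of_notMem hmB]
  have hGγ : ∀ γ : Γ, Measurable fun m => ENNReal.ofReal (Real.exp (n * D.phase ξ (γ • m))) :=
    fun γ => hGm.comp (measurable_const_smul γ)
  refine (measure_mono hsub).trans_lt ((measure_iUnion_le _).trans_lt ?_)
  simp_rw [hpiece]
  rw [← lintegral_tsum fun γ => (hGγ γ).aemeasurable]
  refine (setLIntegral_mono' hBm (g := fun _ => ENNReal.ofReal (Real.exp (n * D.c ξ) *
    (((1 + r) / (1 - r)) ^ n * S))) fun m hm => ?_).trans_lt ?_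
  · have hm' : ‖(m : Euc n)‖ < r := hm
    have h0 := norm_nonneg (m : Euc n)
    obtain ⟨hs1, hs2⟩ := hS m
    have e : ∀ γ : Γ, Real.exp (n * D.phase ξ (γ • m)) =
        Real.exp (n * D.c ξ) * Real.exp (n * busemann ξ ((γ • m : HypBall n) : Euc n)) :=
      fun γ => by rw [← Real.exp_add, OutgoingData.phase]; ring_nf
    simp_rw [e]
    rw [← ENNReal.ofReal_tsum_of_nonneg (fun γ => by positivity) (hs1.mul_left _), tsum_mul_left]
    refine ENNReal.ofReal_le_ofReal (mul_le_mul_of_nonneg_left (hs2.trans ?_) (Real.exp_pos _).le)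
    refine mul_le_mul_of_nonneg_right (pow_le_pow_left₀ ?_ ?_ _) hS0
    · exact div_nonneg (by linarith) (by linarith)
    · exact div_le_div₀ (by linarith) (by linarith) (by linarith) (by linarith)
  · rw [setLIntegral_const]
    exact ENNReal.mul_lt_top ENNReal.ofReal_lt_top (hypVol_ball_lt_top n hr1)

/-- Continuous functions with compact support on `S*M` are integrable over the ball. -/
lemma OutgoingData.integrable_comp_busemannProj {n : ℕ} {Γ : Subgroup (hypIsom n)}
    (hΓ : ProperlyDiscontinuousSMul Γ (HypBall n)) (D : OutgoingData Γ) {ξ : BdrySphere n}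
    (hξ : ξ ∈ discontinuitySet Γ) {a : QuotCotangent Γ → ℝ} (ha : Continuous a)
    (hc : HasCompactSupport a) :
    Integrable (fun m => a (busemannProj Γ ξ m)) (D.horoMeasure ξ) := by
  have := t2Space_quotCotangent hΓ
  have hK : IsCompact (tsupport a) := hc
  obtain ⟨C, hC⟩ := hc.exists_bound_of_continuous ha
  have hcont := ha.comp (continuous_busemannProj Γ ξ)
  have hmeas : MeasurableSet (busemannProj Γ ξ ⁻¹' tsupport a) :=
    (hK.isClosed.preimage (continuous_busemannProj Γ ξ)).measurableSet
  have h1 : IntegrableOn (fun m => a (busemannProj Γ ξ m)) (busemannProj Γ ξ ⁻¹' tsupport a)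
      (D.horoMeasure ξ) :=
    Measure.integrableOn_of_bounded (D.horoMeasure_preimage_lt_top hΓ hξ hK).ne
      hcont.measurable.aestronglyMeasurable (M := C) (Eventually.of_forall fun m => hC _)
  refine (integrableOn_iff_integrable_of_support_subset fun m hm => ?_).1 h1
  exact subset_tsupport a hm

/-- The limiting measure. -/
def OutgoingData.limitMeasure {n : ℕ} {Γ : Subgroup (hypIsom n)} (D : OutgoingData Γ)
    (ξ : BdrySphere n) : Measure (QuotCotangent Γ) :=
  (D.horoMeasure ξ).map (busemannProj Γ ξ)

lemma OutgoingData.integral_limitMeasure {n : ℕ} {Γ : Subgroup (hypIsom n)} (D : OutgoingData Γ)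
    (ξ : BdrySphere n) {a : QuotCotangent Γ → ℝ} (ha : Continuous a) :
    ∫ z, a z ∂(D.limitMeasure ξ) = ∫ m, a (busemannProj Γ ξ m) ∂(D.horoMeasure ξ) :=
  integral_map (continuous_busemannProj Γ ξ).measurable.aemeasurable
    ha.measurable.aestronglyMeasurable

lemma OutgoingData.measurePreserving_horoFlow {n : ℕ} {Γ : Subgroup (hypIsom n)}
    (D : OutgoingData Γ) (ξ : BdrySphere n) (t : ℝ) :
    MeasurePreserving (horoFlow ξ t) (D.horoMeasure ξ) (D.horoMeasure ξ) :=
  _root_.measurePreserving_horoFlow ξ (D.c ξ) t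

/-- After an invariant change of variables only the cut-off to the slice depends on `t`; it
converges pointwise to 1, and `|a|` along `dφ_ξ` is an integrable majorant. -/
lemma OutgoingData.isLimitingMeasure_limitMeasure {n : ℕ} {Γ : Subgroup (hypIsom n)}
    (hΓ : ProperlyDiscontinuousSMul Γ (HypBall n)) (D : OutgoingData Γ) {ξ : BdrySphere n}
    (hξ : ξ ∈ discontinuitySet Γ) : D.IsLimitingMeasure ξ (D.limitMeasure ξ) := by
  have := t2Space_quotCotangent hΓ
  have hproj := (continuous_busemannProj Γ ξ).measurable
  refine ⟨⟨fun K hK => ?_⟩, fun a ha hc => ?_⟩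
  · rw [limitMeasure, Measure.map_apply hproj hK.isClosed.measurableSet]
    exact D.horoMeasure_preimage_lt_top hΓ hξ hK
  have hflow : ∀ t, Continuous fun z => a (quotFlow Γ (-t) z) := fun t =>
    ha.comp (continuous_quotFlow Γ (-t))
  refine ⟨fun t => ?_, ?_⟩
  · have hi := D.integrable_comp_busemannProj hΓ hξ ha hc
    rw [D.outgoingMeasure_eq, integrable_map_measure
      (hflow t).measurable.aestronglyMeasurable hproj.aemeasurable]
    have h2 := ((D.measurePreserving_horoFlow ξ (-t)).integrable_comp hi.aestronglyMeasurable).2 hi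
    refine (h2.restrict (s := D.slice ξ)).congr (Eventually.of_forall fun m => ?_)
    simp only [Function.comp_apply, quotFlow_busemannProj]
  · have hi := D.integrable_comp_busemannProj hΓ hξ ha hc
    have hslice := D.measurableSet_slice ξ
    have hcont : Continuous fun m => a (busemannProj Γ ξ m) :=
      ha.comp (continuous_busemannProj Γ ξ)
    -- Substituting `horoFlow ξ t m` for `m` cancels the backward flow in `a` and moves the time
    -- dependence to the indicator.
    have heq : ∀ t, ∫ z, a (quotFlow Γ (-t) z) ∂(D.outgoingMeasure ξ) =
        ∫ m, (horoFlow ξ t ⁻¹' D.slice ξ).indicator (fun m => a (busemannProj Γ ξ m)) m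
          ∂(D.horoMeasure ξ) := fun t => by
      rw [D.outgoingMeasure_eq, integral_map hproj.aemeasurable
        (hflow t).measurable.aestronglyMeasurable,
        ← integral_indicator hslice]
      have hm : Measurable ((D.slice ξ).indicator
          fun m => a (quotFlow Γ (-t) (busemannProj Γ ξ m))) :=
        ((hflow t).comp (continuous_busemannProj Γ ξ)).measurable.indicator hslice
      have hmp := D.measurePreserving_horoFlow ξ t
      have h3 := integral_map (μ := D.horoMeasure ξ) hmp.measurable.aemeasurable
        (hm.aestronglyMeasurable (μ := (D.horoMeasure ξ).map (horoFlow ξ t)))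
      rw [hmp.map_eq] at h3
      rw [h3]
      refine integral_congr_ae (Eventually.of_forall fun m => ?_)
      simp only [indicator, mem_preimage, quotFlow_busemannProj, horoFlow_neg_horoFlow]
      rfl
    simp_rw [heq]
    rw [D.integral_limitMeasure ξ ha]
    refine tendsto_integral_filter_of_dominated_convergence
      (fun m => ‖a (busemannProj Γ ξ m)‖) (Eventually.of_forall fun t => ?_)
      (Eventually.of_forall fun t => Eventually.of_forall fun m => ?_) hi.norm
      (Eventually.of_forall fun m => ?_)
    · exact (hcont.measurable.indicator
        ((continuous_horoFlow_right ξ t).measurable hslice)).aestronglyMeasurable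
    · exact norm_indicator_le_norm_self _ _
    · refine tendsto_const_nhds.congr' ?_
      filter_upwards [D.eventually_mem_slice hξ m] with t ht
      rw [indicator_of_mem (by exact ht)]

/-- Limiting measures are unique. -/
lemma OutgoingData.IsLimitingMeasure.eq {n : ℕ} {Γ : Subgroup (hypIsom n)}
    (hΓ : ProperlyDiscontinuousSMul Γ (HypBall n)) {D : OutgoingData Γ} {ξ : BdrySphere n}
    {μ μ' : Measure (QuotCotangent Γ)} (h : D.IsLimitingMeasure ξ μ)
    (h' : D.IsLimitingMeasure ξ μ') : μ' = μ := by
  have := t2Space_quotCotangent hΓ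
  have := h.1
  have := h'.1
  -- `S*M` is locally compact, Hausdorff and second countable, so measures finite on compact sets
  -- are determined by their integrals of such functions.
  exact Measure.ext_of_integral_eq_on_compactlySupported fun f =>
    tendsto_nhds_unique (h'.2 f f.continuous f.hasCompactSupport).2
      (h.2 f f.continuous f.hasCompactSupport).2

/-! ### Unfolding over a fundamental domain -/

/-- The exponent in the formula is thus a translate of a single function, as unfolding requires. -/
lemma busemann_bdryMap_add_log {n : ℕ} {Γ : Subgroup (hypIsom n)} (γ : Γ) (ξ : BdrySphere n)
    (m : HypBall n) :
    busemann (bdryMap (γ : hypIsom n) ξ) (m : Euc n) + Real.log (bdryDeriv (γ : hypIsom n) ξ) =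
      busemann ξ ((γ⁻¹ • m : HypBall n) : Euc n) := by
  have h := busemann_bdryMap (γ : hypIsom n) ξ (γ⁻¹ • m)
  have h2 : (γ : Equiv.Perm (HypBall n)) (γ⁻¹ • m) = m := smul_inv_smul γ m
  rw [h2] at h
  rw [h, sub_add_cancel]

/-- Unfolding of the integral of a function over a fundamental domain. -/
lemma integral_eq_setIntegral_tsum_smul {G α : Type*} [Group G] [MulAction G α]
    [MeasurableSpace α] {s : Set α} {μ : Measure α} [MeasurableConstSMul G α]
    [SMulInvariantMeasure G α μ] [Countable G] (hs : IsFundamentalDomain G s μ) {h : α → ℝ}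
    (hm : Measurable h) (hi : Integrable h μ) (hsum : ∀ x, Summable fun g : G => h (g⁻¹ • x)) :
    IntegrableOn (fun x => ∑' g : G, h (g⁻¹ • x)) s μ ∧
      ∫ x, h x ∂μ = ∫ x in s, ∑' g : G, h (g⁻¹ • x) ∂μ := by
  have hmg : ∀ g : G, Measurable fun x => h (g⁻¹ • x) := fun g =>
    hm.comp (measurable_const_smul g⁻¹)
  -- Unfolding the norm of `h` first gives the absolute convergence that permits exchanging sum and
  -- integral.
  have hfin : ∑' g : G, ∫⁻ x in s, ‖h (g⁻¹ • x)‖ₑ ∂μ ≠ ⊤ := by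
    rw [← hs.lintegral_eq_tsum' fun x => ‖h x‖ₑ]
    exact hi.2.ne
  refine ⟨⟨?_, ?_⟩, ?_⟩
  · refine aestronglyMeasurable_of_tendsto_ae (u := (atTop : Filter (Finset G)))
      (f := fun t x => ∑ g ∈ t, h (g⁻¹ • x)) (fun t => ?_)
      (Eventually.of_forall fun x => (hsum x).hasSum)
    exact (Finset.measurable_sum t fun g _ => hmg g).aestronglyMeasurable
  · rw [hasFiniteIntegral_iff_enorm]
    refine (lintegral_mono fun x => enorm_tsum_le_tsum_enorm).trans_lt ?_
    rw [lintegral_tsum fun g => (hmg g).enorm.aemeasurable]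
    exact hfin.lt_top
  · rw [hs.integral_eq_tsum' h hi, integral_tsum (fun g => (hmg g).aestronglyMeasurable) hfin]

/-- The limiting measures in terms of a fundamental domain. -/
lemma OutgoingData.integral_limitMeasure_eq {n : ℕ} {Γ : Subgroup (hypIsom n)}
    (hΓ : ProperlyDiscontinuousSMul Γ (HypBall n)) (D : OutgoingData Γ) {F : Set (HypBall n)}
    (hF : IsFundamentalDomain Γ F (hypVol n)) {ξ : BdrySphere n} (hξ : ξ ∈ discontinuitySet Γ)
    {a : QuotCotangent Γ → ℝ} (ha : Continuous a) (hc : HasCompactSupport a)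
    {h : HypBall n → ℝ}
    (hh : h = fun m => a (busemannProj Γ ξ m) * Real.exp (n * busemann ξ (m : Euc n))) :
    (∀ m : HypBall n, Summable fun γ : Γ => h (γ⁻¹ • m)) ∧
      IntegrableOn (fun m => ∑' γ : Γ, h (γ⁻¹ • m)) F (hypVol n) ∧
      ∫ z, a z ∂(D.limitMeasure ξ) =
        Real.exp (n * D.c ξ) * ∫ m in F, ∑' γ : Γ, h (γ⁻¹ • m) ∂(hypVol n) := by
  have := countable_of_properlyDiscontinuous hΓ
  obtain ⟨C, hC⟩ := hc.exists_bound_of_continuous ha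
  obtain ⟨S, -, hS⟩ := exists_tsum_exp_busemann_le D hξ
  have hsum : ∀ m : HypBall n, Summable fun γ : Γ => h (γ⁻¹ • m) := fun m => by
    have h1 := ((Equiv.inv Γ).summable_iff.2 (hS m).1).mul_left C
    refine Summable.of_norm_bounded h1 fun γ => ?_
    simp only [hh, Function.comp_apply, Equiv.inv_apply]
    rw [norm_mul, Real.norm_of_nonneg (Real.exp_pos _).le]
    exact mul_le_mul_of_nonneg_right (hC _) (Real.exp_pos _).le
  have hm : Measurable h := by
    rw [hh]
    exact ((ha.comp (continuous_busemannProj Γ ξ)).mul (Real.continuous_exp.comp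
      (continuous_const.mul (continuous_busemann ξ)))).measurable
  have hG : Measurable fun m => ENNReal.ofReal (Real.exp (n * D.phase ξ m)) :=
    (continuous_exp_phase D ξ).measurable.ennreal_ofReal
  have hfun : (fun m => (ENNReal.ofReal (Real.exp (n * D.phase ξ m))).toReal •
      a (busemannProj Γ ξ m)) = fun m => Real.exp (n * D.c ξ) * h m := by
    funext m
    rw [ENNReal.toReal_ofReal (Real.exp_pos _).le, OutgoingData.phase, mul_add, Real.exp_add, hh,
      smul_eq_mul]
    ring
  have hi : Integrable h (hypVol n) := by
    have h1 := D.integrable_comp_busemannProj hΓ hξ ha hc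
    rw [OutgoingData.horoMeasure, integrable_withDensity_iff_integrable_smul' hG
      (Eventually.of_forall fun m => ENNReal.ofReal_lt_top), hfun] at h1
    exact (integrable_const_mul_iff (Real.exp_pos _).ne'.isUnit h).1 h1
  obtain ⟨h1, h2⟩ := integral_eq_setIntegral_tsum_smul hF hm hi hsum
  refine ⟨hsum, h1, ?_⟩
  rw [D.integral_limitMeasure ξ ha, OutgoingData.horoMeasure,
    integral_withDensity_eq_integral_toReal_smul hG
      (Eventually.of_forall fun m => ENNReal.ofReal_lt_top), hfun, integral_const_mul, h2]

end

/-! ### Existence, uniqueness and formula for the limiting measure. -/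

theorem mainTheorem8 (n : ℕ) (hn : 1 ≤ n) (Γ : Subgroup (hypIsom n)) (hΓ : IsConvexCocompact Γ)
    (D : OutgoingData Γ) (F : Set (HypBall n)) (hF : IsFundamentalDomain Γ F (hypVol n))
    (ξ : BdrySphere n) (hξ : ξ ∈ discontinuitySet Γ) :
    ∃ μ : Measure (QuotCotangent Γ),
      D.IsLimitingMeasure ξ μ ∧
      (∀ μ' : Measure (QuotCotangent Γ), D.IsLimitingMeasure ξ μ' → μ' = μ) ∧
      ∀ a : QuotCotangent Γ → ℝ, Continuous a → HasCompactSupport a →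
        (∀ m : HypBall n, Summable fun γ : Γ =>
          a (toQuotCotangent Γ (busemannCovector (bdryMap (γ : hypIsom n) ξ) m)) *
            Real.exp (n * (busemann (bdryMap (γ : hypIsom n) ξ) (m : Euc n) +
              Real.log (bdryDeriv (γ : hypIsom n) ξ)))) ∧
        IntegrableOn (fun m : HypBall n => ∑' γ : Γ,
          a (toQuotCotangent Γ (busemannCovector (bdryMap (γ : hypIsom n) ξ) m)) *
            Real.exp (n * (busemann (bdryMap (γ : hypIsom n) ξ) (m : Euc n) +
              Real.log (bdryDeriv (γ : hypIsom n) ξ)))) F (hypVol n) ∧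
        ∫ z, a z ∂μ = Real.exp (n * D.c ξ) * ∫ m in F, ∑' γ : Γ,
          a (toQuotCotangent Γ (busemannCovector (bdryMap (γ : hypIsom n) ξ) m)) *
            Real.exp (n * (busemann (bdryMap (γ : hypIsom n) ξ) (m : Euc n) +
              Real.log (bdryDeriv (γ : hypIsom n) ξ))) ∂(hypVol n) := by
  have hlim := D.isLimitingMeasure_limitMeasure hΓ.discrete hξ
  refine ⟨D.limitMeasure ξ, hlim, fun μ' hμ' => hlim.eq hΓ.discrete hμ', fun a ha hc => ?_⟩
  obtain ⟨h1, h2, h3⟩ := D.integral_limitMeasure_eq hΓ.discrete hF hξ ha hc rfl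
  -- The unfolded sum runs over values at `γ⁻¹ m` with `ξ` fixed; equivariance rewrites them as
  -- values at `m` with boundary point `γ ξ`.
  have hterm : ∀ (m : HypBall n) (γ : Γ),
      a (busemannProj Γ ξ (γ⁻¹ • m)) *
        Real.exp (n * busemann ξ ((γ⁻¹ • m : HypBall n) : Euc n)) =
      a (toQuotCotangent Γ (busemannCovector (bdryMap (γ : hypIsom n) ξ) m)) *
        Real.exp (n * (busemann (bdryMap (γ : hypIsom n) ξ) (m : Euc n) +
          Real.log (bdryDeriv (γ : hypIsom n) ξ))) := fun m γ => by
    rw [busemann_bdryMap_add_log]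
    exact congrArg (fun z => a z * _) (busemannProj_smul Γ γ ξ m).symm
  simp only [hterm] at h1 h2 h3
  exact ⟨h1, h2, h3⟩
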